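/- **Theorem.** Let $d\ge 1$, let $\mathcal X\subset\mathbb R^d$ be a bounded measurable set with Lebesgue measure $1$, let $\alpha>d/2$ and $b=\alpha/d-1/2>0$, and let $D=D_N$ be positive integers with $D_N/N\to\kappa\in(0,\infty)$ as $N\to\infty$. For maps $\mathscr G=\mathscr G_N:\mathbb R^{D}\to L^2(\mathcal X)$ (which may depend on $N$), consider i.i.d. data $Z^{(N)}=(Y_i,X_i)_{i=1}^N$ from the model $$Y_i=\mathscr G(\theta)(X_i)+\varepsilon_i,\qquad \varepsilon_i\sim\mathcal N(0,1)\ \text{independent of}\ X_i\sim \mathrm{Unif}(\mathcal X),$$ with law $P^N_\theta$ and ground truth $\theta_0=0$. Put $\ell_N(\theta)=-\frac12\sum_{i=1}^N|Y_i-\mathscr G(\theta)(X_i)|^2$ and $\ell(\theta)=\mathrm E_{0}^N\ell_N(\theta)$. Let the prior be $\Pi=\mathcal N(0,\Sigma_\alpha)$ on $\mathbb R^D$ with $\Sigma_\alpha=\mathrm{diag}(i^{-2\alpha/d}:1\le i\le D)$, and let $d\Pi(\theta|Z^{(N)})\propto e^{\ell_N(\theta)}d\Pi(\theta)$ be the posterior.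 Write $B_r=\{\theta\in\mathbb R^D:\|\theta\|\le r\}$ and $\Theta_{r,\varepsilon}=\{\theta\in\mathbb R^D: r<\|\theta\|<r+\varepsilon\}$, with $\|\cdot\|$ the Euclidean norm. "With high probability" means with probability tending to $1$ as $N\to\infty$ (under $P_0^N$ unless stated otherwise). Then there exist maps $\mathscr G=\mathscr G_N$ that are radial ($\mathscr G(\theta)$ depends on $\theta$ only through $\|\theta\|$) and a constant $s_b\in(0,1/2)$, not depending on $N$, such that the following hold. **i)** For every $N\ge1$, the expected log-likelihood $\ell$ is unimodal with mode $0$ (that is, $\ell(\theta)<\ell(0)$ for all $\theta\ne0$, and $\ell$ is non-increasing in $\|\theta\|$ on $\mathbb R^D$), concave on a neighbourhood of $0$, radially symmetric, and Lipschitz continuous on $\mathbb R^D$. **ii)** For every fixed $r>0$, with high probability $\ell_N(\theta)$ is radially symmetric and non-increasing in $\|\theta\|$ on $\{\theta:\|\theta\|\ge rN^{-b}\}$. **iii)** With $s=s_bN^{-b}$, we have $\Pi(B_s|Z^{(N)})\to1$ in $P^N_0$-probability as $N\to\infty$. **iv)** There exist $\varepsilon,C>0$ such that the following holds for every $c_0>0$,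 every sequence $\eta_N$ with $\eta_N\in(0,s_bN^{-b})$ for all large $N$, and every sequence of Markov kernels $\mathcal P_N(\theta,A)=\mathcal P_N^{Z^{(N)}}(\theta,A)$ on $\mathbb R^D$ (depending measurably on the data as well as on $\theta$) such that, for all large $N$, $\Pi(\cdot|Z^{(N)})$ is almost surely invariant for $\mathcal P_N$, and such that, with $L_N=C\sqrt N$, with high probability $$\sup_{\theta\in B_{L_N}}\mathcal P_N\big(\theta,\{\vartheta:\|\theta-\vartheta\|\ge\eta_N/2\}\big)\le e^{-c_0N}.$$ There are (non-random) initialisation points $\vartheta_0=\vartheta_{0,N}$, with $\vartheta_0\in\Theta_{N^{-b},\,\varepsilon N^{-b}}$ for all large $N$, such that, with $(\vartheta_k)_{k\ge0}$ the Markov chain with kernel $\mathcal P_N$ started at $\vartheta_0$ and $s=s_bN^{-b}$, the hitting time $\tau_{B_s}=\inf\{k:\vartheta_k\in B_s\}$ satisfies $$\tau_{B_s}\ge\exp\big(\min\{c_0,1\}N/2\big)$$ with probability tending to $1$ as $N\to\infty$ under the joint law of $Z^{(N)}$ and the Markov chain. -/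

import Mathlib

open MeasureTheory ProbabilityTheory Filter Topology
open scoped NNReal ENNReal

/-- Euclidean space of dimension `n` (with the Euclidean norm). -/
abbrev Eucl (n : ℕ) : Type := EuclideanSpace ℝ (Fin n)

/-- A data set of size `N`: the pairs `(Y i, X i)`, with design points in `d`-dimensional space. -/
abbrev RegData (d N : ℕ) : Type := Fin N → ℝ × Eucl d

/-- A regression map `θ ↦ G θ` from `D`-dimensional space into the square-integrable functions on
`𝒳` (for the uniform distribution), jointly measurable so that likelihood and posterior make
sense. -/
structure IsRegressionMap {d D : ℕ} (𝒳 : Set (Eucl d)) (G : Eucl D → Eucl d → ℝ) : Prop where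
  measurable : Measurable (Function.uncurry G)
  memLp : ∀ θ, MemLp (G θ) 2 (volume.restrict 𝒳)

/-- The law of one observation `(Y, X)`, where `Y = G θ X + ε` with independent `X` uniform on `𝒳`
(a set of Lebesgue measure one) and `ε` standard normal. -/
noncomputable def obsLaw {d D : ℕ} (𝒳 : Set (Eucl d)) (G : Eucl D → Eucl d → ℝ) (θ : Eucl D) :
    Measure (ℝ × Eucl d) :=
  ((gaussianReal 0 1).prod (volume.restrict 𝒳)).map (fun p => (G θ p.2 + p.1, p.2))

/-- The law of `N` independent observations under the parameter `θ`. -/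
noncomputable def dataLaw {d D : ℕ} (𝒳 : Set (Eucl d)) (G : Eucl D → Eucl d → ℝ) (N : ℕ)
    (θ : Eucl D) : Measure (RegData d N) :=
  Measure.pi (fun _ => obsLaw 𝒳 G θ)

/-- The empirical log-likelihood `ℓ_N`. -/
noncomputable def logLik {d D N : ℕ} (G : Eucl D → Eucl d → ℝ) (z : RegData d N) (θ : Eucl D) : ℝ :=
  -(1 / 2) * ∑ i, |(z i).1 - G θ (z i).2| ^ 2

/-- The expected log-likelihood `ℓ`, with data generated by the ground truth `0`. -/
noncomputable def expLogLik {d D : ℕ} (𝒳 : Set (Eucl d)) (G : Eucl D → Eucl d → ℝ) (N : ℕ)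
    (θ : Eucl D) : ℝ :=
  ∫ z, logLik G z θ ∂(dataLaw 𝒳 G N 0)

/-- The covariance matrix `diag (i ^ (-2α/d) : i = 1, …, D)` of the `α`-regular prior. -/
noncomputable def maternCov (α : ℝ) (d D : ℕ) : Matrix (Fin D) (Fin D) ℝ :=
  Matrix.diagonal (fun i => ((i : ℝ) + 1) ^ (-(2 * α / d)))

/-- The `α`-regular Gaussian prior. -/
noncomputable def maternPrior (α : ℝ) (d D : ℕ) : Measure (Eucl D) :=
  multivariateGaussian 0 (maternCov α d D)

/-- The posterior distribution, proportional to `exp (ℓ_N θ)` times the prior `pr`. -/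
noncomputable def gibbsPosterior {d D N : ℕ} (pr : Measure (Eucl D)) (G : Eucl D → Eucl d → ℝ)
    (z : RegData d N) : Measure (Eucl D) :=
  pr.tilted (logLik G z)

/-- The open annulus of points whose norm lies strictly between `r` and `r + ε`. -/
def annulus (D : ℕ) (r ε : ℝ) : Set (Eucl D) := {θ | r < ‖θ‖ ∧ ‖θ‖ < r + ε}

/-- The events `A N` hold with high probability. Bounding the (outer) measure of the complement
means, for sets that might fail to be measurable, that `A N` contains a measurable event of
probability tending to one. -/
def WithHighProb {Ω : ℕ → Type} [∀ N, MeasurableSpace (Ω N)] (P : ∀ N, Measure (Ω N))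
    (A : ∀ N, Set (Ω N)) : Prop :=
  Tendsto (fun N => P N (A N)ᶜ) atTop (𝓝 0)

/-- The law on path space of the time-homogeneous Markov chain with transition kernel `K` and
initial distribution `μ₀`. -/
noncomputable def markovChainLaw {S : Type} [MeasurableSpace S] (μ₀ : Measure S)
    (K : Kernel S S) [IsMarkovKernel K] : Measure (ℕ → S) :=
  Kernel.trajMeasure (X := fun _ => S) μ₀
    (fun n => K.comap (fun x : (i : Finset.Iic n) → S => x ⟨n, Finset.mem_Iic.2 le_rfl⟩)
      (measurable_pi_apply _))

/-- The joint law of the data and of the Markov chain: `Z` has law `P` and, given `Z = z`, the path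
`ϑ 0, ϑ 1, …` is a Markov chain with transition kernel `κ (z, ·)` and `ϑ 0 = ϑ₀`. It is obtained
from the chain `(Z, ϑ k)`, whose first component never moves. -/
noncomputable def dataChainLaw {Z E : Type} [MeasurableSpace Z] [MeasurableSpace E]
    (P : Measure Z) (κ : Kernel (Z × E) E) [IsMarkovKernel κ] (ϑ₀ : E) :
    Measure (Z × (ℕ → E)) :=
  (markovChainLaw (P.prod (Measure.dirac ϑ₀))
      (Kernel.deterministic Prod.fst measurable_fst ×ₖ κ)).map
    (fun ω => ((ω 0).1, fun k => (ω k).2))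

/-- The hitting time `inf {k | ϑ k ∈ B}` of a path, infinite if `B` is never visited. -/
noncomputable def hitTime {E : Type} (B : Set E) (ϑ : ℕ → E) : ℕ∞ :=
  hittingAfter (fun k (ω : ℕ → E) => ω k) B 0 ϑ

/-- The assumption on the data-dependent Markov kernels `κ N (z, ·)` with constant `c₀`, radii `L N`
and step sizes `η N`, for prior `pr N` and regression map `G N`: for `N` large, almost surely the
posterior is invariant, and with high probability a step of size at least `η N / 2` has
probability at most `exp (-c₀ N)` from every point of the ball of radius `L N`. -/
structure StepAssumption {d : ℕ} {D : ℕ → ℕ} (𝒳 : Set (Eucl d)) (pr : ∀ N, Measure (Eucl (D N)))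
    (G : ∀ N, Eucl (D N) → Eucl d → ℝ) (c₀ : ℝ) (L η : ℕ → ℝ)
    (κ : ∀ N, Kernel (RegData d N × Eucl (D N)) (Eucl (D N))) : Prop where
  invariant : ∀ᶠ N in atTop, ∀ᵐ z ∂(dataLaw 𝒳 (G N) N 0),
    ((κ N).sectR z).Invariant (gibbsPosterior (pr N) (G N) z)
  steps : WithHighProb (fun N => dataLaw 𝒳 (G N) N 0) (fun N => {z |
    ⨆ θ ∈ Metric.closedBall (0 : Eucl (D N)) (L N), κ N (z, θ) {ϑ | η N / 2 ≤ ‖θ - ϑ‖}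
      ≤ ENNReal.ofReal (Real.exp (-c₀ * N))})

/-! The regression functions are constant on `𝒳`, with value `ramp m R θ`, where `R = s N^(-b)`:
linear in `‖θ‖` up to height `m` at radius `R`, then flat. The log-likelihood is therefore a
quadratic polynomial in the ramp height, whose only random coefficients are sums over the noise. The
claims on its shape follow from this and from Chebyshev's inequality for the sum of the noise
variables.

Contraction and slow mixing coexist because likelihood and prior volume compete at the scale
`exp(-const * N)`. Since `D` is of order `N`, a typical prior draw has scaled norm far above
`N^(-b)`: the annulus `W` between `N^(-b)` and `2 N^(-b)` has prior mass at least `exp(-cN)`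
(`le_maternPrior_annulus`), while for small `s` the ball of radius `2R` has mass at most
`exp(-(c+2)N)` (`maternPrior_closedBall_le`). Yet a ramp of large enough height `m` outweighs this
entropic cost, so that the posterior sits inside radius `R` (`gibbsPosterior_compl_closedBall_le`).

For the hitting time, the posterior restricted to the flat region is a multiple of the prior.
Rescaled by a factor depending on the data, it dominates the prior conditioned on `W`. Invariance
preserves this domination at every time, so a chain started from the conditioned prior visits the
shell between `R` and `2R`, or the far region beyond `C√N`, with probability at most the prior mass
of these sets divided by that of `W`, hence at most `2 exp(-2N)` at each step. Outside these sets,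
the ball can be entered only by a long step, which is rare by assumption. A union bound over time
finishes the estimate for the averaged start (`exists_dataChainLaw_hit_le_of_flat`). The average is
taken jointly over data and start, so some deterministic start does as well as the average. -/

section MarkovChain

/-! ### Marginals of a Markov chain as functions of the initial law. -/

variable {S : Type} [MeasurableSpace S]

/-- The law at time `n` of the Markov chain with kernel `K` and initial law `μ`. -/
noncomputable def chainMarginal (μ : Measure S) (K : Kernel S S) : ℕ → Measure S
  | 0 => μ
  | n + 1 => (chainMarginal μ K n).bind K

lemma isProbabilityMeasure_chainMarginal (μ : Measure S) [IsProbabilityMeasure μ]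
    (K : Kernel S S) [IsMarkovKernel K] (n : ℕ) : IsProbabilityMeasure (chainMarginal μ K n) := by
  induction n with
  | zero => assumption
  | succ n ih => rw [chainMarginal]; infer_instance

/-- Used with `f` the last coordinate of a history, to pass from the history-dependent kernels of
`markovChainLaw` to the two-step Markov property. -/
lemma map_prodMap_compProd_comap {X : Type} [MeasurableSpace X] (μ : Measure X) [SFinite μ]
    (K : Kernel S S) [IsMarkovKernel K] {f : X → S} (hf : Measurable f) :
    (μ ⊗ₘ (K.comap f hf)).map (Prod.map f id) = (μ.map f) ⊗ₘ K := by
  ext s hs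
  rw [Measure.map_apply (by fun_prop) hs,
    Measure.compProd_apply (hs.preimage (by fun_prop)), Measure.compProd_apply hs,
    lintegral_map (Kernel.measurable_kernel_prodMk_left hs) hf]
  rfl

lemma map_pair_markovChainLaw_eq_compProd (μ : Measure S) [IsProbabilityMeasure μ]
    (K : Kernel S S) [IsMarkovKernel K] (n : ℕ) :
    (markovChainLaw μ K).map (fun ω => (ω n, ω (n + 1))) =
      ((markovChainLaw μ K).map (fun ω => ω n)) ⊗ₘ K := by
  have hf : Measurable (fun x : (i : Finset.Iic n) → S => x ⟨n, Finset.mem_Iic.2 le_rfl⟩) :=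
    measurable_pi_apply _
  have h := Kernel.map_frestrictLe_trajMeasure_compProd_eq_map_trajMeasure (X := fun _ => S)
    (μ₀ := μ) (κ := fun n => K.comap (fun x : (i : Finset.Iic n) → S =>
      x ⟨n, Finset.mem_Iic.2 le_rfl⟩) (measurable_pi_apply _)) (a := n)
  have h2 := congrArg (fun m => Measure.map (Prod.map
    (fun x : (i : Finset.Iic n) → S => x ⟨n, Finset.mem_Iic.2 le_rfl⟩) (id : S → S)) m) h
  have : IsProbabilityMeasure (markovChainLaw μ K) := by
    unfold markovChainLaw; infer_instance
  have hm : Measurable (Preorder.frestrictLe (π := fun _ => S) n) :=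
    Preorder.measurable_frestrictLe n
  rw [Measure.map_map (by fun_prop) (by fun_prop)] at h2
  unfold markovChainLaw
  refine Eq.trans h2.symm ?_
  have : IsProbabilityMeasure ((markovChainLaw μ K).map
    (Preorder.frestrictLe (π := fun _ => S) n)) :=
    Measure.isProbabilityMeasure_map hm.aemeasurable
  unfold markovChainLaw at this
  rw [map_prodMap_compProd_comap _ K hf, Measure.map_map hf hm]
  rfl

lemma map_zero_markovChainLaw (μ : Measure S) [IsProbabilityMeasure μ]
    (K : Kernel S S) [IsMarkovKernel K] :
    (markovChainLaw μ K).map (fun ω => ω 0) = μ := by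
  unfold markovChainLaw Kernel.trajMeasure
  have : (fun ω : ℕ → S => ω 0) = (fun x : (i : Finset.Iic 0) → S =>
      x ⟨0, Finset.mem_Iic.2 le_rfl⟩) ∘ Preorder.frestrictLe (π := fun _ => S) 0 := rfl
  rw [this, ← Measure.map_map (by fun_prop) (by fun_prop), Measure.map_comp _ _ (by fun_prop),
    Kernel.traj_map_frestrictLe, Kernel.partialTraj_self, Measure.id_comp,
    Measure.map_map (by fun_prop) (by fun_prop)]
  exact Measure.map_id

lemma map_eval_markovChainLaw (μ : Measure S) [IsProbabilityMeasure μ]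
    (K : Kernel S S) [IsMarkovKernel K] (n : ℕ) :
    (markovChainLaw μ K).map (fun ω => ω n) = chainMarginal μ K n := by
  induction n with
  | zero => exact map_zero_markovChainLaw μ K
  | succ n ih =>
    have h := map_pair_markovChainLaw_eq_compProd μ K n
    have h2 := congrArg (fun m => Measure.map (Prod.snd : S × S → S) m) h
    rw [Measure.map_map (by fun_prop) (by fun_prop)] at h2
    refine Eq.trans h2 ?_
    have := isProbabilityMeasure_chainMarginal μ K n
    rw [ih, chainMarginal]
    exact Measure.snd_compProd _ _

lemma markovChainLaw_pair_apply (μ : Measure S) [IsProbabilityMeasure μ]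
    (K : Kernel S S) [IsMarkovKernel K] (n : ℕ) {s : Set (S × S)} (hs : MeasurableSet s) :
    markovChainLaw μ K {ω | (ω n, ω (n + 1)) ∈ s} =
      ∫⁻ x, K x (Prod.mk x ⁻¹' s) ∂(chainMarginal μ K n) := by
  have := isProbabilityMeasure_chainMarginal μ K n
  rw [← Measure.compProd_apply hs, ← map_eval_markovChainLaw,
    ← map_pair_markovChainLaw_eq_compProd, Measure.map_apply (by fun_prop) hs]
  rfl

lemma markovChainLaw_eval_apply (μ : Measure S) [IsProbabilityMeasure μ]
    (K : Kernel S S) [IsMarkovKernel K] (n : ℕ) {s : Set S} (hs : MeasurableSet s) :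
    markovChainLaw μ K {ω | ω n ∈ s} = chainMarginal μ K n s := by
  rw [← map_eval_markovChainLaw, Measure.map_apply (by fun_prop) hs]
  rfl

/-- Applying a kernel is monotone in the measure. No finiteness of `Q` is needed, which allows a
dominating measure that is not a probability measure. -/
lemma chainMarginal_le_of_bind_eq {μ Q : Measure S} {K : Kernel S S} (hμ : μ ≤ Q)
    (hQ : Q.bind K = Q) (n : ℕ) : chainMarginal μ K n ≤ Q := by
  induction n with
  | zero => exact hμ
  | succ n ih =>
    rw [chainMarginal]
    refine Measure.le_iff.2 fun s hs => ?_
    conv_rhs => rw [← hQ]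
    rw [Measure.bind_apply hs K.measurable.aemeasurable,
      Measure.bind_apply hs K.measurable.aemeasurable]
    exact lintegral_mono' ih le_rfl

/-- By duality, the kernel can act on the function instead of the measure. The resulting `u` is
independent of `μ`, which makes the marginals measurable and linear in the initial law. -/
lemma exists_measurable_lintegral_chainMarginal (K : Kernel S S) (n : ℕ) :
    ∀ f : S → ℝ≥0∞, Measurable f → ∃ u : S → ℝ≥0∞, Measurable u ∧
      ∀ μ : Measure S, ∫⁻ x, f x ∂(chainMarginal μ K n) = ∫⁻ x, u x ∂μ := by
  induction n with
  | zero => exact fun f hf => ⟨f, hf, fun _ => rfl⟩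
  | succ n ih =>
    intro f hf
    obtain ⟨u, hu, h⟩ := ih (fun x => ∫⁻ y, f y ∂(K x)) hf.lintegral_kernel
    refine ⟨u, hu, fun μ => ?_⟩
    rw [← h, chainMarginal, Measure.lintegral_bind K.measurable.aemeasurable hf.aemeasurable]

lemma lintegral_chainMarginal_prod_dirac {Z E : Type} [MeasurableSpace Z] [MeasurableSpace E]
    (P : Measure Z) [SFinite P] (ν : Measure E) [SFinite ν] (K : Kernel (Z × E) (Z × E)) (n : ℕ)
    {s : Set (Z × E)} (hs : MeasurableSet s) :
    Measurable (fun ϑ => chainMarginal (P.prod (Measure.dirac ϑ)) K n s) ∧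
    ∫⁻ ϑ, chainMarginal (P.prod (Measure.dirac ϑ)) K n s ∂ν =
      chainMarginal (P.prod ν) K n s := by
  obtain ⟨u, hu, h⟩ := exists_measurable_lintegral_chainMarginal K n (s.indicator 1)
    (measurable_one.indicator hs)
  simp only [lintegral_indicator_one hs] at h
  have h' : ∀ ϑ, chainMarginal (P.prod (Measure.dirac ϑ)) K n s = ∫⁻ z, u (z, ϑ) ∂P := by
    intro ϑ
    rw [h, lintegral_prod _ hu.aemeasurable]
    refine lintegral_congr fun z => ?_
    rw [lintegral_dirac' _ (by fun_prop)]
  simp only [h']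
  refine ⟨Measurable.lintegral_prod_left' hu, ?_⟩
  rw [h, lintegral_prod_symm _ hu.aemeasurable]

end MarkovChain

/-! ### The joint chain of data and parameter, and hitting times. -/

section DataChain

variable {Z E : Type} [MeasurableSpace Z] [MeasurableSpace E]

/-- The transition kernel of the pair consisting of the data, which never move, and the chain. -/
noncomputable def dataKernel (κ : Kernel (Z × E) E) : Kernel (Z × E) (Z × E) :=
  Kernel.deterministic Prod.fst measurable_fst ×ₖ κ

instance (κ : Kernel (Z × E) E) [IsMarkovKernel κ] : IsMarkovKernel (dataKernel κ) := by
  unfold dataKernel; infer_instance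

lemma dataKernel_apply (κ : Kernel (Z × E) E) [IsMarkovKernel κ] (x : Z × E)
    {s : Set (Z × E)} (hs : MeasurableSet s) :
    dataKernel κ x s = κ x (Prod.mk x.1 ⁻¹' s) := by
  rw [dataKernel, Kernel.prod_apply' _ _ _ hs, Kernel.deterministic_apply,
    lintegral_dirac' _ (measurable_measure_prodMk_left hs)]

/-- A Markov chain that starts outside `B` and can only enter `B` from `A` or by a step in `R`
needs long to hit `B` if it rarely visits `A` and rarely makes steps in `R`. -/
lemma dataChainLaw_hit_le (P : Measure Z) [IsProbabilityMeasure P]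
    (κ : Kernel (Z × E) E) [IsMarkovKernel κ] {A B : Set E} {R : Set (E × E)} {F : Set Z}
    (hA : MeasurableSet A) (hB : MeasurableSet B) (hR : MeasurableSet R) (hF : MeasurableSet F)
    (hcross : ∀ x y, x ∉ B → y ∈ B → x ∈ A ∨ (x, y) ∈ R) {p : ℝ≥0∞}
    (hstep : ∀ z x, z ∉ F → x ∉ A → κ (z, x) (Prod.mk x ⁻¹' R) ≤ p)
    {ϑ : E} (hϑ : ϑ ∉ B) (n : ℕ) :
    dataChainLaw P κ ϑ {ω | ∃ k ≤ n, ω.2 k ∈ B} ≤ P F + ∑ k ∈ Finset.range n,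
      (chainMarginal (P.prod (Measure.dirac ϑ)) (dataKernel κ) k (Set.univ ×ˢ A) + p) := by
  set K := dataKernel κ with hK
  set μ := P.prod (Measure.dirac ϑ) with hμ
  set M := markovChainLaw μ K with hM
  have hset : MeasurableSet {ω : Z × (ℕ → E) | ∃ k ≤ n, ω.2 k ∈ B} := by
    have : {ω : Z × (ℕ → E) | ∃ k ≤ n, ω.2 k ∈ B} =
        ⋃ k, ⋃ (_ : k ≤ n), (fun ω : Z × (ℕ → E) => ω.2 k) ⁻¹' B := by ext; simp
    rw [this]
    exact MeasurableSet.iUnion fun k => MeasurableSet.iUnion fun _ =>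
      hB.preimage (by fun_prop)
  have hmap : dataChainLaw P κ ϑ {ω | ∃ k ≤ n, ω.2 k ∈ B} =
      M {ω | ∃ k ≤ n, (ω k).2 ∈ B} := by
    unfold dataChainLaw
    rw [Measure.map_apply (by fun_prop) hset]
    rfl
  have hR' : MeasurableSet {q : (Z × E) × (Z × E) |
      q.1.1 ∉ F ∧ q.1.2 ∉ A ∧ (q.1.2, q.2.2) ∈ R} := by
    refine MeasurableSet.inter ?_ (MeasurableSet.inter ?_ ?_)
    · exact hF.compl.preimage (by fun_prop)
    · exact hA.compl.preimage (by fun_prop)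
    · exact hR.preimage (by fun_prop)
  have hF' : MeasurableSet {q : (Z × E) × (Z × E) | q.1.1 ∉ F ∧ q.2.1 ∈ F} :=
    MeasurableSet.inter (hF.compl.preimage (by fun_prop)) (hF.preimage (by fun_prop))
  have hA' : MeasurableSet ((Set.univ : Set Z) ×ˢ A) := MeasurableSet.univ.prod hA
  -- A path that hits `B` by time `n` starts in `F` or in `B`, or before time `n` visits `A`, moves
  -- its data component into `F`, or makes a step in `R` from outside `A` with data outside `F`.
  have hsub : {ω : ℕ → Z × E | ∃ k ≤ n, (ω k).2 ∈ B} ⊆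
      ({ω | ω 0 ∈ F ×ˢ Set.univ} ∪ {ω | ω 0 ∈ Set.univ ×ˢ B}) ∪
        ⋃ k ∈ Finset.range n, (({ω | ω k ∈ Set.univ ×ˢ A} ∪
          {ω | (ω k, ω (k + 1)) ∈ {q : (Z × E) × (Z × E) | q.1.1 ∉ F ∧ q.2.1 ∈ F}}) ∪
          {ω | (ω k, ω (k + 1)) ∈ {q : (Z × E) × (Z × E) |
            q.1.1 ∉ F ∧ q.1.2 ∉ A ∧ (q.1.2, q.2.2) ∈ R}}) := by
    intro ω hω
    by_contra hcon
    simp only [Set.mem_union, Set.mem_iUnion, Set.mem_ofPred_eq, Finset.mem_range, not_or,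
      not_exists, Set.mem_prod, Set.mem_univ, true_and, and_true, not_and] at hcon
    obtain ⟨⟨h0, h0B⟩, hk⟩ := hcon
    have hall : ∀ k ≤ n, (ω k).1 ∉ F ∧ (ω k).2 ∉ B := by
      intro k
      induction k with
      | zero => exact fun _ => ⟨h0, h0B⟩
      | succ k ih =>
        intro hkn
        obtain ⟨i1, i2⟩ := ih (by omega)
        obtain ⟨⟨j1, j2⟩, j3⟩ := hk k (by omega)
        refine ⟨j2 i1, fun hB' => ?_⟩
        rcases hcross _ _ i2 hB' with h | h
        · exact j1 h
        · exact j3 i1 j1 h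
    obtain ⟨k, hkn, hkB⟩ := hω
    exact (hall k hkn).2 hkB
  rw [hmap]
  refine (measure_mono hsub).trans ?_
  refine (measure_union_le _ _).trans (add_le_add ?_ ?_)
  · refine (measure_union_le _ _).trans ?_
    rw [hM, markovChainLaw_eval_apply _ _ _ (hF.prod MeasurableSet.univ),
      markovChainLaw_eval_apply _ _ _ (MeasurableSet.univ.prod hB)]
    simp only [chainMarginal, hμ, Measure.prod_prod, measure_univ, mul_one, one_mul]
    rw [Measure.dirac_apply' _ hB]
    simp [hϑ]
  · refine (measure_biUnion_finset_le _ _).trans (Finset.sum_le_sum fun k _ => ?_)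
    refine (measure_union_le _ _).trans (add_le_add ?_ ?_)
    · refine (measure_union_le _ _).trans ?_
      rw [hM, markovChainLaw_eval_apply _ _ _ hA', markovChainLaw_pair_apply _ _ _ hF']
      -- The event that the data component moves into `F` is null, because `dataKernel` keeps this
      -- component fixed.
      refine (add_le_add le_rfl (le_of_eq ?_)).trans (add_zero _).le
      rw [lintegral_eq_zero_iff (Kernel.measurable_kernel_prodMk_left hF')]
      refine Eventually.of_forall fun x => ?_
      simp only [Pi.zero_apply]
      rw [hK, dataKernel_apply _ _ (hF'.preimage (by fun_prop))]
      convert! measure_empty (μ := κ x)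
      ext y
      simp only [Set.mem_preimage, Set.mem_ofPred_eq, Set.mem_empty_iff_false, iff_false]
      tauto
    · rw [hM, markovChainLaw_pair_apply _ _ _ hR']
      have := isProbabilityMeasure_chainMarginal μ K k
      refine (lintegral_mono (g := fun _ => p) fun x => ?_).trans (by simp)
      dsimp only
      rw [hK, dataKernel_apply _ _ (hR'.preimage (by fun_prop))]
      by_cases hx : x.1 ∉ F ∧ x.2 ∉ A
      · refine (measure_mono ?_).trans (hstep x.1 x.2 hx.1 hx.2)
        intro y hy
        exact hy.2.2
      · refine le_trans (le_of_eq ?_) zero_le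
        convert! measure_empty (μ := κ x)
        ext y
        simp only [Set.mem_preimage, Set.mem_ofPred_eq, Set.mem_empty_iff_false, iff_false]
        tauto

/-- If `Q` is an invariant measure that dominates the initial law `P.prod ν`, then from some
starting point in `W` the chain needs long to hit `B`. -/
lemma exists_dataChainLaw_hit_le (P : Measure Z) [IsProbabilityMeasure P] (ν : Measure E)
    [IsProbabilityMeasure ν]
    (κ : Kernel (Z × E) E) [IsMarkovKernel κ] {A B W : Set E} {R : Set (E × E)} {F : Set Z}
    (hA : MeasurableSet A) (hB : MeasurableSet B) (hR : MeasurableSet R) (hF : MeasurableSet F)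
    (hcross : ∀ x y, x ∉ B → y ∈ B → x ∈ A ∨ (x, y) ∈ R) {p q : ℝ≥0∞}
    (hstep : ∀ z x, z ∉ F → x ∉ A → κ (z, x) (Prod.mk x ⁻¹' R) ≤ p)
    (hWB : ∀ ϑ ∈ W, ϑ ∉ B) (hW : ν Wᶜ = 0) {Q : Measure (Z × E)}
    (hinv : Q.bind (dataKernel κ) = Q) (hle : P.prod ν ≤ Q) (hQA : Q (Set.univ ×ˢ A) ≤ q)
    (n : ℕ) :
    ∃ ϑ ∈ W, dataChainLaw P κ ϑ {ω | ∃ k ≤ n, ω.2 k ∈ B} ≤ P F + n * (q + p) := by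
  have hA' : MeasurableSet ((Set.univ : Set Z) ×ˢ A) := MeasurableSet.univ.prod hA
  have hint : ∫⁻ ϑ, ∑ k ∈ Finset.range n,
      chainMarginal (P.prod (Measure.dirac ϑ)) (dataKernel κ) k (Set.univ ×ˢ A) ∂ν ≤ n * q := by
    rw [lintegral_finsetSum _ fun k _ => (lintegral_chainMarginal_prod_dirac P ν _ k hA').1]
    refine (Finset.sum_le_card_nsmul _ _ q fun k _ => ?_).trans (by simp)
    rw [(lintegral_chainMarginal_prod_dirac P ν _ k hA').2]
    exact (chainMarginal_le_of_bind_eq hle hinv k _).trans hQA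
  -- First moment method: some point outside the null set `Wᶜ` does not exceed the `ν`-average of
  -- the expected number of visits to `A`.
  obtain ⟨ϑ, hϑW, hϑ⟩ := exists_notMem_null_le_lintegral (Finset.measurable_sum _ fun k _ =>
    (lintegral_chainMarginal_prod_dirac P ν (dataKernel κ) k hA').1).aemeasurable hW
  simp only [Set.mem_compl_iff, not_not] at hϑW
  refine ⟨ϑ, hϑW, (dataChainLaw_hit_le P κ hA hB hR hF hcross hstep (hWB ϑ hϑW) n).trans ?_⟩
  rw [Finset.sum_add_distrib, mul_add]
  exact add_le_add le_rfl (add_le_add (hϑ.trans hint) (by simp))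

/-- An integrand `h` on `Z × E` for which almost all sections are densities of invariant measures
is the density of an invariant measure of the chain on `Z × E`. -/
lemma withDensity_bind_dataKernel (P : Measure Z) [SFinite P] (pr : Measure E) [SFinite pr]
    (κ : Kernel (Z × E) E) [IsMarkovKernel κ] {h : Z × E → ℝ≥0∞} (hh : Measurable h)
    (hinv : ∀ᵐ z ∂P, (κ.sectR z).Invariant (pr.withDensity fun θ => h (z, θ))) :
    ((P.prod pr).withDensity h).bind (dataKernel κ) = (P.prod pr).withDensity h := by
  ext s hs
  have hm : Measurable fun x => dataKernel κ x s := (dataKernel κ).measurable_coe hs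
  rw [Measure.bind_apply hs (dataKernel κ).measurable.aemeasurable,
    lintegral_withDensity_eq_lintegral_mul _ hh hm, withDensity_apply _ hs,
    ← lintegral_indicator hs, lintegral_prod _ (hh.mul hm).aemeasurable,
    lintegral_prod _ (hh.indicator hs).aemeasurable]
  refine lintegral_congr_ae (hinv.mono fun z hz => ?_)
  have hs' : MeasurableSet (Prod.mk z ⁻¹' s) := hs.preimage (by fun_prop)
  have h1 := congrArg (fun m : Measure E => m (Prod.mk z ⁻¹' s)) hz.def
  dsimp only at h1 ⊢
  rw [Measure.bind_apply hs' (Kernel.measurable _).aemeasurable,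
    lintegral_withDensity_eq_lintegral_mul _ (by fun_prop)
      ((κ.sectR z).measurable_coe hs'), withDensity_apply _ hs', ← lintegral_indicator hs'] at h1
  refine Eq.trans (lintegral_congr fun θ => ?_) (h1.trans (lintegral_congr fun θ => ?_))
  · exact congrArg (h (z, θ) * ·) (dataKernel_apply κ (z, θ) hs)
  · rfl

end DataChain

/-! ### Gaussian bounds for tails, small balls and annuli of the prior. -/

section GaussianPrior

lemma integrable_and_integral_exp_mul_sq_gaussianReal {c : ℝ} (hc : c < 1 / 2) :
    Integrable (fun x : ℝ => Real.exp (c * x ^ 2)) (gaussianReal 0 1) ∧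
      ∫ x, Real.exp (c * x ^ 2) ∂(gaussianReal 0 1) = (√(1 - 2 * c))⁻¹ := by
  have hpdf : ∀ x : ℝ, gaussianPDFReal 0 1 x • Real.exp (c * x ^ 2) =
      (√(2 * Real.pi))⁻¹ * Real.exp (-(1 / 2 - c) * x ^ 2) := by
    intro x
    rw [gaussianPDFReal, smul_eq_mul, mul_assoc, ← Real.exp_add]
    simp only [NNReal.coe_one, mul_one]
    congr 2
    ring
  constructor
  · rw [gaussianReal_of_var_ne_zero _ one_ne_zero,
      integrable_withDensity_iff_integrable_smul₀' (measurable_gaussianPDF _ _).aemeasurable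
        (ae_of_all _ fun x => gaussianPDF_lt_top)]
    simp only [toReal_gaussianPDF, hpdf]
    exact (integrable_exp_neg_mul_sq (by linarith)).const_mul _
  · rw [integral_gaussianReal_eq_integral_smul one_ne_zero]
    simp only [hpdf]
    rw [integral_const_mul, integral_gaussian, ← Real.sqrt_inv, ← Real.sqrt_inv,
      ← Real.sqrt_mul (by positivity)]
    congr 1
    have := Real.pi_pos
    have : 1 / 2 - c ≠ 0 := by linarith
    have : 1 - 2 * c ≠ 0 := by linarith
    field_simp

/-- Chernoff bound for a chi-square variable. Positive `c` controls the upper tail and negative `c`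
the probability of small values. -/
lemma pi_gaussianReal_sum_sq_le (D : ℕ) {c : ℝ} (hc : c < 1 / 2) (a : ℝ) :
    (Measure.pi fun _ : Fin D => gaussianReal 0 1).real {g | a ≤ c * ∑ i, g i ^ 2} ≤
      Real.exp (-a) * ((√(1 - 2 * c))⁻¹) ^ D := by
  obtain ⟨hi, hv⟩ := integrable_and_integral_exp_mul_sq_gaussianReal hc
  have hprod : ∀ g : Fin D → ℝ, Real.exp (c * ∑ i, g i ^ 2) = ∏ i, Real.exp (c * g i ^ 2) := by
    intro g
    rw [← Real.exp_sum, Finset.mul_sum]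
  have hint : Integrable (fun g : Fin D → ℝ => Real.exp (c * ∑ i, g i ^ 2))
      (Measure.pi fun _ : Fin D => gaussianReal 0 1) := by
    simp only [hprod]
    exact Integrable.fintype_prod (f := fun _ x => Real.exp (c * x ^ 2)) fun _ => hi
  have h := mul_meas_ge_le_integral_of_nonneg (ae_of_all _ fun g => (Real.exp_pos _).le) hint
    (Real.exp a)
  simp only [hprod] at h
  rw [integral_fintype_prod_eq_pow (fun x => Real.exp (c * x ^ 2)), hv, Fintype.card_fin] at h
  simp only [← hprod, Real.exp_le_exp] at h
  rw [Real.exp_neg, inv_mul_eq_div, le_div_iff₀ (Real.exp_pos _), mul_comm]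
  exact h

open scoped MatrixOrder in
lemma maternPrior_eq_map (α : ℝ) (d D : ℕ) :
    maternPrior α d D = (Measure.pi fun _ : Fin D => gaussianReal 0 1).map
      (fun g => WithLp.toLp 2 fun i : Fin D => ((i : ℝ) + 1) ^ (-(α / d)) * g i) := by
  have hsqrt : CFC.sqrt (maternCov α d D) =
      Matrix.diagonal (fun i : Fin D => ((i : ℝ) + 1) ^ (-(α / d))) := by
    apply CFC.sqrt_unique
    · rw [maternCov, Matrix.diagonal_mul_diagonal]
      congr 1
      ext i
      rw [← Real.rpow_add (by positivity)]
      congr 1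
      ring
    · rw [Matrix.nonneg_iff_posSemidef]
      exact Matrix.PosSemidef.diagonal fun i => by simp only [Pi.zero_apply]; positivity
  rw [maternPrior, multivariateGaussian, ← map_pi_eq_stdGaussian,
    Measure.map_map (by fun_prop) (by fun_prop), hsqrt]
  congr 1
  ext g i
  simp [Matrix.toEuclideanCLM_toLp, Matrix.mulVec_diagonal]

instance (α : ℝ) (d D : ℕ) : IsProbabilityMeasure (maternPrior α d D) := by
  unfold maternPrior; infer_instance

lemma maternPrior_real_apply (α : ℝ) (d D : ℕ) {s : Set (Eucl D)} (hs : MeasurableSet s) :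
    (maternPrior α d D).real s = (Measure.pi fun _ : Fin D => gaussianReal 0 1).real
      {g | WithLp.toLp 2 (fun i : Fin D => ((i : ℝ) + 1) ^ (-(α / d)) * g i) ∈ s} := by
  rw [maternPrior_eq_map, map_measureReal_apply (by fun_prop) hs]
  rfl

lemma norm_sq_scaled (γ : ℝ) {D : ℕ} (g : Fin D → ℝ) :
    ‖(WithLp.toLp 2 fun i : Fin D => ((i : ℝ) + 1) ^ (-γ) * g i : Eucl D)‖ ^ 2 =
      ∑ i : Fin D, (((i : ℝ) + 1) ^ (-γ) * g i) ^ 2 := by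
  rw [EuclideanSpace.real_norm_sq_eq]

/-- All scaling factors are at most `1`, so the norm is dominated by that of a standard Gaussian
vector; the Chernoff bound is applied with `c = 1/4`. -/
lemma maternPrior_tail_le {α : ℝ} (hα : 0 ≤ α) (d D : ℕ) {R : ℝ} (hR : 0 ≤ R) :
    (maternPrior α d D).real {θ | R ≤ ‖θ‖} ≤ Real.exp (-(R ^ 2 / 4)) * (√2) ^ D := by
  rw [maternPrior_real_apply _ _ _ (measurableSet_le measurable_const measurable_norm)]
  have h := pi_gaussianReal_sum_sq_le D (c := 1 / 4) (by norm_num) (R ^ 2 / 4)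
  have h2 : (√(1 - 2 * (1 / 4) : ℝ))⁻¹ = √2 := by
    rw [← Real.sqrt_inv]; norm_num
  rw [h2] at h
  refine (measureReal_mono fun g hg => ?_).trans h
  have h3 : R ^ 2 ≤ _ := pow_le_pow_left₀ hR hg 2
  rw [norm_sq_scaled] at h3
  have h4 : ∑ i : Fin D, (((i : ℝ) + 1) ^ (-(α / d)) * g i) ^ 2 ≤ ∑ i, g i ^ 2 := by
    refine Finset.sum_le_sum fun i _ => ?_
    rw [mul_pow]
    refine mul_le_of_le_one_left (sq_nonneg _) (pow_le_one₀ (by positivity) ?_)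
    refine Real.rpow_le_one_of_one_le_of_nonpos (by simp) ?_
    have : 0 ≤ α / d := by positivity
    linarith
  show R ^ 2 / 4 ≤ 1 / 4 * ∑ i, g i ^ 2
  linarith

/-- The smallest scaling factor is `D^(-α/d)`, so a draw in the ball forces the standard Gaussian
vector to have squared norm at most `τ * D`. The Chernoff parameter `-1/τ` then gives a base that
tends to `0` with `τ`. -/
lemma maternPrior_closedBall_le {α : ℝ} (hα : 0 ≤ α) (d D : ℕ) {R τ : ℝ} (hτ : 0 < τ)
    (hR : R ^ 2 * ((D : ℝ) ^ (α / d)) ^ 2 ≤ τ * D) :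
    (maternPrior α d D).real (Metric.closedBall 0 R) ≤
      (Real.exp 1 * (√(1 + 2 / τ))⁻¹) ^ D := by
  rw [maternPrior_real_apply _ _ _ Metric.isClosed_closedBall.measurableSet]
  have hτ' : 0 < 1 / τ := by positivity
  have h := pi_gaussianReal_sum_sq_le D (c := -(1 / τ)) (by linarith) (-D)
  have h2 : 1 - 2 * -(1 / τ) = 1 + 2 / τ := by ring
  rw [h2, neg_neg, ← Real.exp_one_pow, ← mul_pow] at h
  refine (measureReal_mono fun g hg => ?_).trans h
  have h3 : ‖_‖ ^ 2 ≤ R ^ 2 :=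
    pow_le_pow_left₀ (norm_nonneg _) (mem_closedBall_zero_iff.1 hg) 2
  rw [norm_sq_scaled] at h3
  have h4 : ∑ i, g i ^ 2 ≤ (∑ i : Fin D, (((i : ℝ) + 1) ^ (-(α / d)) * g i) ^ 2) *
      ((D : ℝ) ^ (α / d)) ^ 2 := by
    rw [Finset.sum_mul]
    refine Finset.sum_le_sum fun i _ => ?_
    have hi : (1 : ℝ) ≤ ((i : ℝ) + 1) ^ (-(α / d)) * (D : ℝ) ^ (α / d) := by
      rw [Real.rpow_neg (by positivity), inv_mul_eq_div, one_le_div (by positivity)]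
      refine Real.rpow_le_rpow (by positivity) ?_ (by positivity)
      exact_mod_cast i.2
    rw [mul_pow, mul_right_comm, ← mul_pow]
    exact le_mul_of_one_le_left (sq_nonneg _) (one_le_pow₀ hi)
  have h5 : ∑ i, g i ^ 2 ≤ τ * D :=
    h4.trans ((mul_le_mul_of_nonneg_right h3 (sq_nonneg _)).trans hR)
  show -(D : ℝ) ≤ -(1 / τ) * ∑ i, g i ^ 2
  have h6 : 1 / τ * ∑ i, g i ^ 2 ≤ 1 / τ * (τ * D) := mul_le_mul_of_nonneg_left h5 hτ'.le
  have h7 : 1 / τ * (τ * D) = D := by field_simp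
  linarith

lemma le_gaussianReal_Ioo {x K : ℝ} (hx : 0 ≤ x) (hxK : x ≤ K) :
    x * ((√(2 * Real.pi))⁻¹ * Real.exp (-(2 * K ^ 2))) ≤
      (gaussianReal 0 1).real (Set.Ioo x (2 * x)) := by
  rw [measureReal_def, gaussianReal_apply_eq_integral _ one_ne_zero,
    ENNReal.toReal_ofReal (integral_nonneg fun _ => gaussianPDFReal_nonneg _ _ _)]
  have hc : x * ((√(2 * Real.pi))⁻¹ * Real.exp (-(2 * K ^ 2))) =
      ∫ _ in Set.Ioo x (2 * x), ((√(2 * Real.pi))⁻¹ * Real.exp (-(2 * K ^ 2))) := by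
    rw [setIntegral_const, Real.volume_real_Ioo_of_le (by linarith), smul_eq_mul]
    ring
  rw [hc]
  refine setIntegral_mono_on (integrableOn_const (by simp)) (integrable_gaussianPDFReal _ _).integrableOn
    measurableSet_Ioo fun y hy => ?_
  rw [gaussianPDFReal]
  simp only [NNReal.coe_one, mul_one, sub_zero]
  gcongr
  have : y ^ 2 ≤ (2 * K) ^ 2 := pow_le_pow_left₀ (hx.trans hy.1.le) (by linarith [hy.2]) 2
  linarith

lemma factorial_eq_prod_fin (D : ℕ) : (D.factorial : ℝ) = ∏ i : Fin D, ((i : ℝ) + 1) := by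
  rw [← Finset.prod_range_add_one_eq_factorial, Fin.prod_univ_eq_prod_range (fun i => (i : ℝ) + 1)]
  push_cast
  rfl

/-- A single term of the exponential series at `D` is at most its sum. -/
lemma div_exp_pow_le_factorial (D : ℕ) : ((D : ℝ) / Real.exp 1) ^ D ≤ D.factorial := by
  rw [div_pow, div_le_iff₀ (by positivity), Real.exp_one_pow, mul_comm,
    ← div_le_iff₀ (by positivity)]
  exact Real.pow_div_factorial_le_exp _ (by positivity) _

/-- If every scaled coordinate lies between `δ = R/√D` and `2δ`, the norm lies between `R` and `2R`.
The probability of this box factorises; its side lengths multiply to `δ^D * (D!)^(α/d)`, and `D! ≥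
(D/e)^D` accounts for the factor `exp(-α/d)`. -/
lemma le_maternPrior_annulus {α : ℝ} (hα : 0 ≤ α) (d : ℕ) {D : ℕ} (hD : 1 ≤ D) {R K : ℝ}
    (hR : 0 < R) (hK : K = R / √D * (D : ℝ) ^ (α / d)) :
    (K * Real.exp (-(α / d)) * ((√(2 * Real.pi))⁻¹ * Real.exp (-(2 * K ^ 2)))) ^ D ≤
      (maternPrior α d D).real (annulus D R R) := by
  have hD0 : (0 : ℝ) < D := by exact_mod_cast hD
  set γ := α / d with hγ
  have hγ0 : 0 ≤ γ := by positivity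
  set δ := R / √D with hδ
  have hδ0 : 0 < δ := by positivity
  have hδ2 : D * δ ^ 2 = R ^ 2 := by
    rw [hδ, div_pow, Real.sq_sqrt hD0.le]; field_simp
  have hmeas : MeasurableSet (annulus D R R) :=
    (measurableSet_lt measurable_const measurable_norm).inter
      (measurableSet_lt measurable_norm measurable_const)
  rw [maternPrior_real_apply _ _ _ hmeas]
  set x : Fin D → ℝ := fun i => δ * ((i : ℝ) + 1) ^ γ with hx
  have hx0 : ∀ i, 0 ≤ x i := fun i => by positivity
  have hxK : ∀ i, x i ≤ K := by
    intro i
    rw [hK]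
    refine mul_le_mul_of_nonneg_left (Real.rpow_le_rpow (by positivity) ?_ hγ0) hδ0.le
    exact_mod_cast i.2
  have hsub : Set.univ.pi (fun i => Set.Ioo (x i) (2 * x i)) ⊆
      {g | WithLp.toLp 2 (fun i : Fin D => ((i : ℝ) + 1) ^ (-γ) * g i) ∈ annulus D R R} := by
    intro g hg
    have hne : (Finset.univ : Finset (Fin D)).Nonempty := ⟨⟨0, hD⟩, Finset.mem_univ _⟩
    have hcoord : ∀ i : Fin D, δ < ((i : ℝ) + 1) ^ (-γ) * g i ∧
        ((i : ℝ) + 1) ^ (-γ) * g i < 2 * δ := by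
      intro i
      obtain ⟨h1, h2⟩ := hg i (Set.mem_univ i)
      have hp : (0 : ℝ) < ((i : ℝ) + 1) ^ γ := by positivity
      rw [Real.rpow_neg (by positivity), inv_mul_eq_div, lt_div_iff₀ hp, div_lt_iff₀ hp]
      exact ⟨h1, by simpa only [hx, mul_assoc] using h2⟩
    have hlow : R ^ 2 < ‖(WithLp.toLp 2 fun i : Fin D =>
        ((i : ℝ) + 1) ^ (-γ) * g i : Eucl D)‖ ^ 2 := by
      rw [norm_sq_scaled, ← hδ2]
      calc (D : ℝ) * δ ^ 2 = ∑ _ : Fin D, δ ^ 2 := by simp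
        _ < _ := Finset.sum_lt_sum_of_nonempty hne fun i _ =>
          pow_lt_pow_left₀ (hcoord i).1 hδ0.le two_ne_zero
    have hup : ‖(WithLp.toLp 2 fun i : Fin D =>
        ((i : ℝ) + 1) ^ (-γ) * g i : Eucl D)‖ ^ 2 < (R + R) ^ 2 := by
      rw [norm_sq_scaled]
      calc _ < ∑ _ : Fin D, (2 * δ) ^ 2 := Finset.sum_lt_sum_of_nonempty hne fun i _ =>
          pow_lt_pow_left₀ (hcoord i).2 (hδ0.le.trans (hcoord i).1.le) two_ne_zero
        _ = 4 * (D * δ ^ 2) := by simp; ring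
        _ = (R + R) ^ 2 := by rw [hδ2]; ring
    exact ⟨lt_of_pow_lt_pow_left₀ 2 (norm_nonneg _) hlow,
      lt_of_pow_lt_pow_left₀ 2 (by positivity) hup⟩
  refine le_trans ?_ (measureReal_mono hsub)
  rw [measureReal_def, Measure.pi_pi, ENNReal.toReal_prod]
  calc _ ≤ ∏ i, (x i * ((√(2 * Real.pi))⁻¹ * Real.exp (-(2 * K ^ 2)))) := by
        rw [Finset.prod_mul_distrib, mul_pow]
        simp only [Finset.prod_const, Finset.card_univ, Fintype.card_fin]
        refine mul_le_mul_of_nonneg_right ?_ (by positivity)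
        rw [Finset.prod_mul_distrib, Real.finsetProd_rpow _ _ fun i _ => by positivity,
          ← factorial_eq_prod_fin, hK]
        simp only [Finset.prod_const, Finset.card_univ, Fintype.card_fin]
        have h1 : δ * (D : ℝ) ^ γ * Real.exp (-γ) = δ * ((D : ℝ) / Real.exp 1) ^ γ := by
          rw [Real.div_rpow hD0.le (Real.exp_pos _).le, ← Real.exp_mul, one_mul, Real.exp_neg]
          ring
        rw [h1, mul_pow, ← Real.rpow_mul_natCast (by positivity), mul_comm γ,
          Real.rpow_natCast_mul (by positivity)]
        gcongr
        exact div_exp_pow_le_factorial D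
    _ ≤ _ := Finset.prod_le_prod (fun i _ => mul_nonneg (hx0 i) (by positivity))
        fun i _ => le_gaussianReal_Ioo (hx0 i) (hxK i)

end GaussianPrior

/-! ### Exponential rates for the prior when `D` is proportional to `N`. -/

section PriorAsymptotics

lemma eventually_dimension_bounds {κ : ℝ} (hκ : 0 < κ) {D : ℕ → ℕ}
    (hD : Tendsto (fun N => (D N : ℝ) / (N : ℝ)) atTop (𝓝 κ)) :
    ∀ᶠ N : ℕ in atTop, 1 ≤ N ∧ 1 ≤ D N ∧ κ / 2 * N ≤ D N ∧ (D N : ℝ) ≤ 2 * κ * N := by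
  filter_upwards [hD.eventually_const_lt (show κ / 2 < κ by linarith),
    hD.eventually_lt_const (show κ < 2 * κ by linarith), eventually_ge_atTop 1] with N h1 h2 h3
  have hN : (0 : ℝ) < N := by exact_mod_cast h3
  rw [lt_div_iff₀ hN] at h1
  rw [div_lt_iff₀ hN] at h2
  refine ⟨h3, ?_, h1.le, h2.le⟩
  have : (0 : ℝ) < D N := lt_trans (by positivity) h1
  exact_mod_cast this

lemma exists_exp_le_maternPrior_annulus {κ : ℝ} (hκ : 0 < κ) {D : ℕ → ℕ}
    (hD : Tendsto (fun N => (D N : ℝ) / (N : ℝ)) atTop (𝓝 κ)) {α b : ℝ} {d : ℕ}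
    (hα : 0 ≤ α) (hb : b = α / d - 1 / 2) (hb0 : 0 < b) {ρ : ℝ} (hρ : 0 < ρ) :
    ∃ c : ℝ, 0 ≤ c ∧ ∀ᶠ N : ℕ in atTop, Real.exp (-(c * N)) ≤
      (maternPrior α d (D N)).real (annulus (D N) (ρ * (N : ℝ) ^ (-b)) (ρ * (N : ℝ) ^ (-b))) := by
  set k₁ := ρ * (κ / 2) ^ b with hk₁
  set k₂ := ρ * (2 * κ) ^ b with hk₂
  set f := k₁ * Real.exp (-(α / d)) * ((√(2 * Real.pi))⁻¹ * Real.exp (-(2 * k₂ ^ 2))) with hf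
  have hf0 : 0 < f := by positivity
  refine ⟨2 * κ * |Real.log f|, by positivity, ?_⟩
  filter_upwards [eventually_dimension_bounds hκ hD] with N ⟨hN, hDN, hl, hu⟩
  have hN0 : (0 : ℝ) < N := by exact_mod_cast hN
  have hD0 : (0 : ℝ) < D N := by exact_mod_cast hDN
  -- The relation `α/d = b + 1/2` makes `N^(-b)` the critical radius: the parameter `K` of the
  -- annulus bound depends on `N` only through `D/N`, so it stays between `k₁` and `k₂`.
  set K := ρ * ((D N : ℝ) / N) ^ b with hK
  have hKeq : K = ρ * (N : ℝ) ^ (-b) / √(D N) * (D N : ℝ) ^ (α / d) := by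
    have : α / d = b + 1 / 2 := by linarith
    rw [this, Real.rpow_add hD0, ← Real.sqrt_eq_rpow, hK, Real.div_rpow hD0.le hN0.le,
      Real.rpow_neg hN0.le]
    have : √(D N : ℝ) ≠ 0 := by positivity
    field_simp
  refine le_trans ?_ (le_maternPrior_annulus hα d hDN (by positivity) hKeq)
  have hK₁ : k₁ ≤ K := by
    refine mul_le_mul_of_nonneg_left (Real.rpow_le_rpow (by positivity) ?_ hb0.le) hρ.le
    rwa [le_div_iff₀ hN0]
  have hK₂ : K ≤ k₂ := by
    refine mul_le_mul_of_nonneg_left (Real.rpow_le_rpow (by positivity) ?_ hb0.le) hρ.le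
    rwa [div_le_iff₀ hN0]
  have hK0 : 0 ≤ K := by positivity
  calc Real.exp (-(2 * κ * |Real.log f| * N)) ≤ Real.exp (D N * Real.log f) := by
        rw [Real.exp_le_exp]
        have h1 : D N * -Real.log f ≤ 2 * κ * N * |Real.log f| :=
          (mul_le_mul_of_nonneg_left (neg_le_abs _) hD0.le).trans
            (mul_le_mul_of_nonneg_right hu (abs_nonneg _))
        linarith
    _ = f ^ D N := by rw [Real.exp_nat_mul, Real.exp_log hf0]
    _ ≤ _ := by
        rw [hf]
        gcongr

lemma exists_maternPrior_closedBall_le_exp {κ : ℝ} (hκ : 0 < κ) {D : ℕ → ℕ}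
    (hD : Tendsto (fun N => (D N : ℝ) / (N : ℝ)) atTop (𝓝 κ)) {α b : ℝ} {d : ℕ}
    (hα : 0 ≤ α) (hb : b = α / d - 1 / 2) (hb0 : 0 < b) (c : ℝ) :
    ∃ s : ℝ, 0 < s ∧ s < 1 / 2 ∧ ∀ᶠ N : ℕ in atTop,
      (maternPrior α d (D N)).real (Metric.closedBall 0 (2 * (s * (N : ℝ) ^ (-b)))) ≤
        Real.exp (-(c * N)) := by
  wlog hc : 0 ≤ c generalizing c
  · obtain ⟨s, hs, hs', h⟩ := this 0 le_rfl
    refine ⟨s, hs, hs', h.mono fun N hN => hN.trans ?_⟩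
    rw [Real.exp_le_exp]
    have : c * N ≤ 0 := mul_nonpos_of_nonpos_of_nonneg (not_le.1 hc).le (by positivity)
    linarith
  -- Chosen so that `2/τ = exp(1 + 2c/κ)^2`. The base of the small ball bound is then at most
  -- `exp(-2c/κ)`, which with `D ≥ κN/2` yields the rate `c`.
  set τ := 2 * Real.exp (-(2 + 4 * c / κ)) with hτ
  have hτ0 : 0 < τ := by positivity
  set s := min (√τ / (2 * (2 * κ) ^ b)) (1 / 4) with hs
  have hs0 : 0 < s := by positivity
  refine ⟨s, hs0, (min_le_right _ _).trans_lt (by norm_num), ?_⟩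
  filter_upwards [eventually_dimension_bounds hκ hD] with N ⟨hN, hDN, hl, hu⟩
  have hN0 : (0 : ℝ) < N := by exact_mod_cast hN
  have hD0 : (0 : ℝ) < D N := by exact_mod_cast hDN
  have hR : (2 * (s * (N : ℝ) ^ (-b))) ^ 2 * (((D N : ℕ) : ℝ) ^ (α / d)) ^ 2 ≤ τ * (D N : ℕ) := by
    have h1 : α / d = b + 1 / 2 := by linarith
    have h2 : 2 * (s * (N : ℝ) ^ (-b)) * (D N : ℝ) ^ (α / d) =
        2 * s * ((D N : ℝ) / N) ^ b * √(D N) := by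
      rw [h1, Real.rpow_add hD0, ← Real.sqrt_eq_rpow, Real.div_rpow hD0.le hN0.le,
        Real.rpow_neg hN0.le]
      ring
    have h3 : 2 * s * ((D N : ℝ) / N) ^ b ≤ √τ := by
      have h4 : ((D N : ℝ) / N) ^ b ≤ (2 * κ) ^ b :=
        Real.rpow_le_rpow (by positivity) (by rwa [div_le_iff₀ hN0]) hb0.le
      have h5 : s ≤ √τ / (2 * (2 * κ) ^ b) := min_le_left _ _
      rw [le_div_iff₀ (by positivity)] at h5
      calc 2 * s * ((D N : ℝ) / N) ^ b ≤ 2 * s * (2 * κ) ^ b := by gcongr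
        _ ≤ √τ := by linarith
    rw [← mul_pow, h2, mul_pow, Real.sq_sqrt hD0.le]
    refine mul_le_mul_of_nonneg_right ?_ hD0.le
    rw [← Real.sq_sqrt hτ0.le]
    exact pow_le_pow_left₀ (by positivity) h3 2
  refine (maternPrior_closedBall_le hα d (D N) hτ0 hR).trans ?_
  have hbase : Real.exp 1 * (√(1 + 2 / τ))⁻¹ ≤ Real.exp (-(2 * c / κ)) := by
    have h1 : 2 / τ = Real.exp (1 + 2 * c / κ) ^ 2 := by
      rw [hτ, Real.exp_neg, ← Real.exp_nat_mul]
      have : ((2 : ℕ) : ℝ) * (1 + 2 * c / κ) = 2 + 4 * c / κ := by push_cast; ring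
      rw [this]
      field_simp
    have h2 : Real.exp (1 + 2 * c / κ) ≤ √(1 + 2 / τ) := by
      rw [h1]
      exact Real.le_sqrt_of_sq_le (by linarith)
    rw [← div_eq_mul_inv, div_le_iff₀ ((Real.exp_pos _).trans_le h2)]
    calc Real.exp 1 = Real.exp (-(2 * c / κ)) * Real.exp (1 + 2 * c / κ) := by
          rw [← Real.exp_add]; congr 1; ring
      _ ≤ _ := by gcongr
  calc _ ≤ Real.exp (-(2 * c / κ)) ^ D N := by gcongr
    _ = Real.exp (D N * -(2 * c / κ)) := (Real.exp_nat_mul _ _).symm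
    _ ≤ _ := by
      rw [Real.exp_le_exp]
      have h1 : κ / 2 * N * (2 * c / κ) ≤ D N * (2 * c / κ) :=
        mul_le_mul_of_nonneg_right hl (by positivity)
      have h2 : κ / 2 * N * (2 * c / κ) = c * N := by field_simp
      linarith

lemma exists_maternPrior_tail_le_exp {κ : ℝ} (hκ : 0 < κ) {D : ℕ → ℕ}
    (hD : Tendsto (fun N => (D N : ℝ) / (N : ℝ)) atTop (𝓝 κ)) {α : ℝ} {d : ℕ}
    (hα : 0 ≤ α) {c : ℝ} (hc : 0 ≤ c) :
    ∃ C : ℝ, 0 < C ∧ ∀ᶠ N : ℕ in atTop,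
      (maternPrior α d (D N)).real {θ | C * √(N : ℝ) ≤ ‖θ‖} ≤ Real.exp (-(c * N)) := by
  -- The square of this constant over `4` is `c + 2κ`, where `2κ` absorbs the factor `(√2)^D ≤
  -- exp(D) ≤ exp(2κN)`.
  refine ⟨2 * √(c + 2 * κ), by positivity, ?_⟩
  filter_upwards [eventually_dimension_bounds hκ hD] with N ⟨hN, hDN, hl, hu⟩
  refine (maternPrior_tail_le hα d (D N) (by positivity)).trans ?_
  have h1 : (2 * √(c + 2 * κ) * √(N : ℝ)) ^ 2 / 4 = (c + 2 * κ) * N := by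
    rw [mul_pow, mul_pow, Real.sq_sqrt (by positivity), Real.sq_sqrt (by positivity)]
    ring
  have h2 : √2 ≤ Real.exp 1 := by
    refine (Real.sqrt_le_left (by positivity)).2 ?_
    have := Real.add_one_le_exp 1
    nlinarith
  calc _ ≤ Real.exp (-((c + 2 * κ) * N)) * Real.exp 1 ^ D N := by rw [h1]; gcongr
    _ = Real.exp (-((c + 2 * κ) * N) + D N) := by
      rw [Real.exp_one_pow, ← Real.exp_add]
    _ ≤ _ := by
      rw [Real.exp_le_exp]
      linarith

end PriorAsymptotics

/-! ### The ramp model: likelihood, noise and posterior contraction. -/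

section RampModel

/-- The radial function that grows linearly from `0` to `m` on the ball of radius `R` and is
constant outside. -/
noncomputable def ramp (m R : ℝ) {D : ℕ} (θ : Eucl D) : ℝ := m * min 1 (‖θ‖ / R)

variable {d D N : ℕ} {m R : ℝ}

lemma continuous_ramp : Continuous (ramp m R : Eucl D → ℝ) := by
  unfold ramp; fun_prop

lemma ramp_zero : ramp m R (0 : Eucl D) = 0 := by simp [ramp]

lemma ramp_le_ramp (hm : 0 ≤ m) (hR : 0 ≤ R) {θ θ' : Eucl D} (h : ‖θ‖ ≤ ‖θ'‖) :
    ramp m R θ ≤ ramp m R θ' := by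
  unfold ramp; gcongr

lemma ramp_nonneg (hm : 0 ≤ m) (hR : 0 ≤ R) (θ : Eucl D) : 0 ≤ ramp m R θ := by
  unfold ramp; positivity

lemma ramp_pos (hm : 0 < m) (hR : 0 < R) {θ : Eucl D} (hθ : θ ≠ 0) : 0 < ramp m R θ := by
  have := norm_pos_iff.2 hθ
  unfold ramp; positivity

lemma ramp_le (hm : 0 ≤ m) (θ : Eucl D) : ramp m R θ ≤ m :=
  mul_le_of_le_one_right hm (min_le_left _ _)

lemma ramp_eq (hR : 0 < R) {θ : Eucl D} (hθ : R ≤ ‖θ‖) : ramp m R θ = m := by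
  rw [ramp, min_eq_left ((one_le_div hR).2 hθ), mul_one]

lemma ramp_eq_of_le (hR : 0 < R) {θ : Eucl D} (hθ : ‖θ‖ ≤ R) : ramp m R θ = m / R * ‖θ‖ := by
  rw [ramp, min_eq_right ((div_le_one hR).2 hθ)]
  ring

/-- The regression map with values in the constant functions given by `ramp`. -/
noncomputable def rampMap (m R : ℝ) (d : ℕ) {D : ℕ} : Eucl D → Eucl d → ℝ := fun θ _ => ramp m R θ

lemma isRegressionMap_rampMap {𝒳 : Set (Eucl d)} [IsProbabilityMeasure (volume.restrict 𝒳)] :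
    IsRegressionMap 𝒳 (rampMap m R d : Eucl D → Eucl d → ℝ) where
  measurable := continuous_ramp.measurable.comp measurable_fst
  memLp _ := memLp_const _

lemma obsLaw_rampMap_zero {𝒳 : Set (Eucl d)} :
    obsLaw 𝒳 (rampMap m R d) (0 : Eucl D) = (gaussianReal 0 1).prod (volume.restrict 𝒳) := by
  simp only [obsLaw, rampMap, ramp_zero, zero_add]
  exact Measure.map_id

instance {𝒳 : Set (Eucl d)} [IsProbabilityMeasure (volume.restrict 𝒳)] :
    IsProbabilityMeasure (obsLaw 𝒳 (rampMap m R d) (0 : Eucl D)) := by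
  rw [obsLaw_rampMap_zero]; infer_instance

instance {𝒳 : Set (Eucl d)} [IsProbabilityMeasure (volume.restrict 𝒳)] :
    IsProbabilityMeasure (dataLaw 𝒳 (rampMap m R d) N (0 : Eucl D)) := by
  unfold dataLaw; infer_instance

lemma measurePreserving_fst_obsLaw {𝒳 : Set (Eucl d)}
    [IsProbabilityMeasure (volume.restrict 𝒳)] :
    MeasurePreserving Prod.fst (obsLaw 𝒳 (rampMap m R d) (0 : Eucl D)) (gaussianReal 0 1) := by
  rw [obsLaw_rampMap_zero]; exact measurePreserving_fst

lemma measurePreserving_noise {𝒳 : Set (Eucl d)} [IsProbabilityMeasure (volume.restrict 𝒳)]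
    (i : Fin N) :
    MeasurePreserving (fun z : RegData d N => (z i).1)
      (dataLaw 𝒳 (rampMap m R d) N (0 : Eucl D)) (gaussianReal 0 1) :=
  measurePreserving_fst_obsLaw.comp
    (measurePreserving_eval (fun _ : Fin N => obsLaw 𝒳 (rampMap m R d) (0 : Eucl D)) i)

lemma logLik_rampMap (z : RegData d N) (θ : Eucl D) :
    logLik (rampMap m R d) z θ = -(1 / 2) * ∑ i, (z i).1 ^ 2 + ramp m R θ * ∑ i, (z i).1
      - N / 2 * ramp m R θ ^ 2 := by
  have h : ∀ i, |(z i).1 - ramp m R θ| ^ 2 =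
      (z i).1 ^ 2 - 2 * ramp m R θ * (z i).1 + ramp m R θ ^ 2 := by
    intro i
    rw [sq_abs]
    ring
  simp only [logLik, rampMap, h, Finset.sum_add_distrib, Finset.sum_sub_distrib, ← Finset.mul_sum,
    Finset.sum_const, Finset.card_univ, Fintype.card_fin, nsmul_eq_mul]
  ring

lemma measurable_logLik_rampMap :
    Measurable fun p : RegData d N × Eucl D => logLik (rampMap m R d) p.1 p.2 := by
  have := (continuous_ramp (m := m) (R := R) (D := D)).measurable
  simp only [logLik_rampMap]
  fun_prop

lemma expLogLik_rampMap {𝒳 : Set (Eucl d)} [IsProbabilityMeasure (volume.restrict 𝒳)]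
    (θ : Eucl D) :
    expLogLik 𝒳 (rampMap m R d) N θ = -(N / 2) * (1 + ramp m R θ ^ 2) := by
  set P := dataLaw 𝒳 (rampMap m R d) N (0 : Eucl D) with hP
  have hid : MemLp (id : ℝ → ℝ) 2 (gaussianReal 0 1) := memLp_id_gaussianReal' 2 (by simp)
  have hp := fun i : Fin N => measurePreserving_noise (𝒳 := 𝒳) (m := m) (R := R) (D := D) i
  have hmem : ∀ i : Fin N, MemLp (fun z : RegData d N => (z i).1) 2 P := fun i =>
    hid.comp_measurePreserving (hp i)
  have hi1 : ∀ i : Fin N, Integrable (fun z : RegData d N => (z i).1) P := fun i =>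
    (hmem i).integrable (by norm_num)
  have hi2 : ∀ i : Fin N, Integrable (fun z : RegData d N => (z i).1 ^ 2) P := fun i =>
    (hmem i).integrable_sq
  have he1 : ∀ i : Fin N, ∫ z, (z i).1 ∂P = 0 := by
    intro i
    rw [← integral_map (f := fun y : ℝ => y) (hp i).aemeasurable (by fun_prop), (hp i).map_eq,
      integral_id_gaussianReal]
  have he2 : ∀ i : Fin N, ∫ z, (z i).1 ^ 2 ∂P = 1 := by
    intro i
    rw [← integral_map (f := fun y : ℝ => y ^ 2) (hp i).aemeasurable (by fun_prop), (hp i).map_eq]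
    have h := variance_of_integral_eq_zero (μ := gaussianReal 0 1) (X := id) (by fun_prop)
      integral_id_gaussianReal
    rw [variance_id_gaussianReal] at h
    exact h.symm
  simp only [expLogLik, logLik_rampMap, ← hP]
  have hs1 : Integrable (fun z : RegData d N => ramp m R θ * ∑ i, (z i).1) P :=
    (integrable_finsetSum _ fun i _ => hi1 i).const_mul _
  have hs2 : Integrable (fun z : RegData d N => -(1 / 2 : ℝ) * ∑ i, (z i).1 ^ 2) P :=
    (integrable_finsetSum _ fun i _ => hi2 i).const_mul _
  have hs3 : Integrable (fun z : RegData d N => -(1 / 2 : ℝ) * ∑ i, (z i).1 ^ 2 +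
      ramp m R θ * ∑ i, (z i).1) P := hs2.add hs1
  rw [integral_sub hs3 (integrable_const _), integral_add hs2 hs1,
    integral_const_mul, integral_const_mul, integral_finsetSum _ fun i _ => hi2 i,
    integral_finsetSum _ fun i _ => hi1 i]
  simp only [he1, he2, integral_const, probReal_univ]
  simp
  ring

/-- Chebyshev's inequality: under the ground truth `0` the responses are independent standard
normals, so their sum has variance `N`. -/
lemma measure_noise_ge_le {𝒳 : Set (Eucl d)} [IsProbabilityMeasure (volume.restrict 𝒳)]
    (hN : 1 ≤ N) {c : ℝ} (hc : 0 < c) :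
    dataLaw 𝒳 (rampMap m R d) N (0 : Eucl D) {z | c * N ≤ |∑ i, (z i).1|} ≤
      ENNReal.ofReal (1 / (c ^ 2 * N)) := by
  have hN0 : (0 : ℝ) < N := by exact_mod_cast hN
  have hid : MemLp (id : ℝ → ℝ) 2 (gaussianReal 0 1) := memLp_id_gaussianReal' 2 (by simp)
  have hfst : MemLp (Prod.fst : ℝ × Eucl d → ℝ) 2 (obsLaw 𝒳 (rampMap m R d) (0 : Eucl D)) :=
    hid.comp_measurePreserving measurePreserving_fst_obsLaw
  have hvar : Var[(Prod.fst : ℝ × Eucl d → ℝ); obsLaw 𝒳 (rampMap m R d) (0 : Eucl D)] = 1 := by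
    have h := variance_map (X := id) (Y := (Prod.fst : ℝ × Eucl d → ℝ))
      (μ := obsLaw 𝒳 (rampMap m R d) (0 : Eucl D)) (by fun_prop) (by fun_prop)
    rw [measurePreserving_fst_obsLaw.map_eq, variance_id_gaussianReal] at h
    exact h.symm
  have hsum := variance_sum_pi (μ := fun _ : Fin N => obsLaw 𝒳 (rampMap m R d) (0 : Eucl D))
    (X := fun _ => Prod.fst) fun _ => hfst
  simp only [hvar, Finset.sum_const, Finset.card_univ, Fintype.card_fin, nsmul_eq_mul,
    mul_one] at hsum
  set P := dataLaw 𝒳 (rampMap m R d) N (0 : Eucl D) with hP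
  have hmem : ∀ i : Fin N, MemLp (fun z : RegData d N => (z i).1) 2 P := fun i =>
    hid.comp_measurePreserving (measurePreserving_noise i)
  have hmemS : MemLp (∑ i, fun z : RegData d N => (z i).1) 2 P := memLp_finsetSum' _ fun i _ => hmem i
  have hmean : ∫ z, (∑ i, fun z : RegData d N => (z i).1) z ∂P = 0 := by
    simp only [Finset.sum_apply]
    rw [integral_finsetSum _ fun i _ => (hmem i).integrable (by norm_num)]
    refine Finset.sum_eq_zero fun i _ => ?_
    have hp := measurePreserving_noise (𝒳 := 𝒳) (m := m) (R := R) (D := D) i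
    rw [← integral_map (f := fun y : ℝ => y) hp.aemeasurable (by fun_prop), hp.map_eq,
      integral_id_gaussianReal]
  have h := meas_ge_le_variance_div_sq hmemS (c := c * N) (by positivity)
  rw [hmean] at h
  simp only [sub_zero, Finset.sum_apply] at h
  refine h.trans (ENNReal.ofReal_le_ofReal (le_of_eq ?_))
  have hsum' : Var[∑ i, fun z : RegData d N => (z i).1; P] = N := hsum
  rw [hsum']
  field_simp

/-- As a function of the ramp height, the log-likelihood is a downward parabola with vertex at the
mean response (for `N ≥ 1`). This mean is at most `c`, and only heights from `c` on are compared. -/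
lemma logLik_rampMap_anti (hm : 0 ≤ m) (hR : 0 ≤ R) {z : RegData d N} {θ θ' : Eucl D} {c : ℝ}
    (hz : ∑ i, (z i).1 ≤ c * N) (hc : c ≤ ramp m R θ) (h : ‖θ‖ ≤ ‖θ'‖) :
    logLik (rampMap m R d) z θ' ≤ logLik (rampMap m R d) z θ := by
  have h1 : ramp m R θ ≤ ramp m R θ' := ramp_le_ramp hm hR h
  rw [logLik_rampMap, logLik_rampMap]
  have h2 : ∑ i, (z i).1 ≤ (ramp m R θ + ramp m R θ') / 2 * N :=
    hz.trans (mul_le_mul_of_nonneg_right (by linarith) (by positivity))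
  nlinarith [mul_nonneg (sub_nonneg.2 h1) (sub_nonneg.2 h2)]

lemma lipschitzWith_ramp (hm : 0 ≤ m) (hR : 0 < R) :
    LipschitzWith (m / R).toNNReal (ramp m R : Eucl D → ℝ) := by
  refine LipschitzWith.of_dist_le_mul fun θ θ' => ?_
  rw [Real.coe_toNNReal _ (by positivity), Real.dist_eq, dist_eq_norm]
  unfold ramp
  rw [← mul_sub, abs_mul, abs_of_nonneg hm, div_mul_eq_mul_div, mul_div_assoc]
  refine mul_le_mul_of_nonneg_left ?_ hm
  refine (abs_min_sub_min_le_max _ _ _ _).trans ?_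
  rw [sub_self, abs_zero, ← sub_div, abs_div, abs_of_pos hR]
  refine max_le (by positivity) ?_
  gcongr
  exact abs_norm_sub_norm_le _ _

lemma exists_lipschitzWith_expLogLik {𝒳 : Set (Eucl d)}
    [IsProbabilityMeasure (volume.restrict 𝒳)] (hm : 0 ≤ m) (hR : 0 < R) :
    ∃ K : ℝ≥0, LipschitzWith K (expLogLik 𝒳 (rampMap m R d : Eucl D → Eucl d → ℝ) N) := by
  refine ⟨(N * m * (m / R)).toNNReal, LipschitzWith.of_dist_le_mul fun θ θ' => ?_⟩
  have h := (lipschitzWith_ramp (D := D) hm hR).dist_le_mul θ θ'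
  rw [Real.coe_toNNReal _ (by positivity)] at h ⊢
  rw [Real.dist_eq] at h
  rw [expLogLik_rampMap, expLogLik_rampMap, Real.dist_eq]
  have h1 : -(N / 2 : ℝ) * (1 + ramp m R θ ^ 2) - -(N / 2) * (1 + ramp m R θ' ^ 2) =
      -(N / 2) * (ramp m R θ + ramp m R θ') * (ramp m R θ - ramp m R θ') := by ring
  rw [h1, abs_mul, abs_mul, abs_neg, abs_of_nonneg (by positivity : (0 : ℝ) ≤ N / 2),
    abs_of_nonneg (add_nonneg (ramp_nonneg hm hR.le θ) (ramp_nonneg hm hR.le θ'))]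
  calc (N / 2 : ℝ) * (ramp m R θ + ramp m R θ') * |ramp m R θ - ramp m R θ'|
      ≤ (N / 2 : ℝ) * (m + m) * (m / R * dist θ θ') := by
        gcongr
        · exact ramp_le hm θ
        · exact ramp_le hm θ'
    _ = N * m * (m / R) * dist θ θ' := by ring

/-- Below radius `R` the ramp is linear in the norm, so the expected log-likelihood is a constant
minus a multiple of `‖θ‖ ^ 2`. -/
lemma concaveOn_expLogLik {𝒳 : Set (Eucl d)}
    [IsProbabilityMeasure (volume.restrict 𝒳)] (hR : 0 < R) :
    ConcaveOn ℝ (Metric.ball (0 : Eucl D) R) (expLogLik 𝒳 (rampMap m R d) N) := by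
  have hconv : ConvexOn ℝ (Metric.ball (0 : Eucl D) R) fun θ => ‖θ‖ ^ 2 :=
    (convexOn_norm (convex_ball _ _)).pow (fun _ _ => norm_nonneg _) 2
  have h := ((hconv.smul (c := N / 2 * (m / R) ^ 2) (by positivity)).neg).add_const (-(N / 2 : ℝ))
  refine h.congr fun θ hθ => ?_
  rw [expLogLik_rampMap, ramp_eq_of_le hR (mem_ball_zero_iff.1 hθ).le]
  simp only [Pi.add_apply, Pi.neg_apply, smul_eq_mul]
  ring

lemma integrable_exp_logLik_rampMap (pr : Measure (Eucl D)) [IsFiniteMeasure pr]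
    (z : RegData d N) : Integrable (fun θ => Real.exp (logLik (rampMap m R d) z θ)) pr := by
  have hramp := (continuous_ramp (m := m) (R := R) (D := D)).measurable
  have hmeas : Measurable fun θ : Eucl D => logLik (rampMap m R d) z θ := by
    simp only [logLik_rampMap]
    fun_prop
  refine Integrable.of_bound hmeas.exp.aestronglyMeasurable 1 (ae_of_all _ fun θ => ?_)
  rw [Real.norm_eq_abs, Real.abs_exp, Real.exp_le_one_iff]
  have : 0 ≤ ∑ i, |(z i).1 - rampMap m R d θ (z i).2| ^ 2 :=
    Finset.sum_nonneg fun _ _ => by positivity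
  rw [logLik]
  linarith

/-- Posterior contraction: if the small ball of radius `R / 2` has enough prior mass, compared
with the height `m` of the ramp, the posterior concentrates on the ball of radius `R`. -/
lemma gibbsPosterior_compl_closedBall_le (pr : Measure (Eucl D)) [IsProbabilityMeasure pr]
    (hR : 0 < R) {c : ℝ} (hc : 0 ≤ c) (hm : m = 2 * (c + 1))
    (hpr : Real.exp (-(c * N)) ≤ pr.real (Metric.closedBall 0 (R / 2))) {z : RegData d N}
    (hz : |∑ i, (z i).1| ≤ 1 / 6 * N) :
    (gibbsPosterior pr (rampMap m R d) z).real (Metric.closedBall 0 R)ᶜ ≤ Real.exp (-N) := by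
  have hm0 : 0 ≤ m := by linarith
  have hi := integrable_exp_logLik_rampMap (m := m) (R := R) (D := D) pr z
  set base := -(1 / 2) * ∑ i, (z i).1 ^ 2 with hbase
  set S := ∑ i, (z i).1 with hS
  obtain ⟨hz1, hz2⟩ := abs_le.1 hz
  have hN0 : (0 : ℝ) ≤ N := by positivity
  set Zz := ∫ θ, Real.exp (logLik (rampMap m R d) z θ) ∂pr with hZz
  -- On the ball of radius `R / 2` the ramp is at most `m / 2`; the noise then costs at most `N * m
  -- / 12`, the quadratic term at most `N * m ^ 2 / 8`, and the prior mass at most `c * N` in the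
  -- exponent.
  have hlow : Real.exp (base - N * (m / 12 + m ^ 2 / 8) - c * N) ≤ Zz := by
    calc _ = Real.exp (base - N * (m / 12 + m ^ 2 / 8)) * Real.exp (-(c * N)) := by
          rw [← Real.exp_add]; congr 1
      _ ≤ Real.exp (base - N * (m / 12 + m ^ 2 / 8)) * pr.real (Metric.closedBall 0 (R / 2)) := by
          gcongr
      _ = ∫ θ in Metric.closedBall 0 (R / 2), Real.exp (base - N * (m / 12 + m ^ 2 / 8)) ∂pr := by
          rw [setIntegral_const, smul_eq_mul, mul_comm]
      _ ≤ ∫ θ in Metric.closedBall 0 (R / 2), Real.exp (logLik (rampMap m R d) z θ) ∂pr := by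
          refine setIntegral_mono_on (integrable_const _) hi.integrableOn
            Metric.isClosed_closedBall.measurableSet fun θ hθ => ?_
          rw [Real.exp_le_exp, logLik_rampMap]
          have hθ' : ‖θ‖ ≤ R / 2 := mem_closedBall_zero_iff.1 hθ
          have h0 := ramp_nonneg hm0 hR.le θ
          have h1 : ramp m R θ ≤ m / 2 := by
            rw [ramp_eq_of_le hR (by linarith)]
            calc m / R * ‖θ‖ ≤ m / R * (R / 2) := by gcongr
              _ = m / 2 := by field_simp
          have h2 : ramp m R θ * -(1 / 6 * N) ≤ ramp m R θ * S :=
            mul_le_mul_of_nonneg_left hz1 h0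
          have h3 : ramp m R θ * (1 / 6 * N) ≤ m / 2 * (1 / 6 * N) := by gcongr
          have h4 : N / 2 * ramp m R θ ^ 2 ≤ N / 2 * (m / 2) ^ 2 := by gcongr
          linarith
      _ ≤ Zz := setIntegral_le_integral hi (ae_of_all _ fun _ => (Real.exp_pos _).le)
  have hZ0 : 0 < Zz := (Real.exp_pos _).trans_le hlow
  have hup : ∫ θ in (Metric.closedBall 0 R)ᶜ, Real.exp (logLik (rampMap m R d) z θ) ∂pr ≤
      Real.exp (base + N * (m / 6 - m ^ 2 / 2)) := by
    calc _ ≤ ∫ θ in (Metric.closedBall 0 R)ᶜ, Real.exp (base + N * (m / 6 - m ^ 2 / 2)) ∂pr := by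
          refine setIntegral_mono_on hi.integrableOn (integrable_const _)
            Metric.isClosed_closedBall.measurableSet.compl fun θ hθ => ?_
          have hθ' : R < ‖θ‖ := by simpa using hθ
          rw [Real.exp_le_exp, logLik_rampMap, ramp_eq hR hθ'.le]
          have h2 : m * S ≤ m * (1 / 6 * N) := mul_le_mul_of_nonneg_left hz2 hm0
          linarith
      _ ≤ _ := by
          rw [setIntegral_const, smul_eq_mul]
          exact mul_le_of_le_one_left (Real.exp_pos _).le measureReal_le_one
  rw [gibbsPosterior, measureReal_def, tilted_apply_eq_ofReal_integral' _
    Metric.isClosed_closedBall.measurableSet.compl, ENNReal.toReal_ofReal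
      (integral_nonneg fun _ => by positivity), integral_div, div_le_iff₀ hZ0]
  refine hup.trans (le_trans ?_ (mul_le_mul_of_nonneg_left hlow (Real.exp_pos _).le))
  rw [← Real.exp_add, Real.exp_le_exp]
  -- With `u = c + 1` and `m = 2 * u` this is `3/2 * u ^ 2 ≥ 3/2 * u`, true as `u ≥ 1`.
  have hkey : m / 6 - m ^ 2 / 2 ≤ -1 - (m / 12 + m ^ 2 / 8) - c := by
    rw [hm]
    nlinarith
  have := mul_le_mul_of_nonneg_left hkey hN0
  linarith

end RampModel

/-! ### Slow mixing caused by a flat likelihood. -/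

section SlowMixing

/-- Suppose the log-likelihood does not depend on the parameter on a region `T`. Then a Markov
chain with the posterior as invariant measure that is started at a suitable point of `W ⊆ T` needs
long to hit `B`, if the prior mass of the set `A ⊆ T` that it has to cross is small compared with
the prior mass of `W`. -/
lemma exists_dataChainLaw_hit_le_of_flat {Z E : Type} [MeasurableSpace Z] [MeasurableSpace E]
    (P : Measure Z) [IsProbabilityMeasure P] (pr : Measure E) [IsProbabilityMeasure pr]
    (κ : Kernel (Z × E) E) [IsMarkovKernel κ] {ℓ : Z × E → ℝ} (hℓ : Measurable ℓ)
    (hint : ∀ z, Integrable (fun θ => Real.exp (ℓ (z, θ))) pr) {base : Z → ℝ}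
    (hbase : Measurable base) {T : Set E} (hT : ∀ z, ∀ θ ∈ T, ℓ (z, θ) = base z)
    {A B W : Set E} {R : Set (E × E)} {F : Set Z}
    (hA : MeasurableSet A) (hB : MeasurableSet B) (hWm : MeasurableSet W) (hR : MeasurableSet R)
    (hF : MeasurableSet F) (hAT : A ⊆ T) (hWT : W ⊆ T) (hW0 : pr W ≠ 0)
    (hcross : ∀ x y, x ∉ B → y ∈ B → x ∈ A ∨ (x, y) ∈ R) {p : ℝ≥0∞}
    (hstep : ∀ z x, z ∉ F → x ∉ A → κ (z, x) (Prod.mk x ⁻¹' R) ≤ p)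
    (hWB : ∀ ϑ ∈ W, ϑ ∉ B)
    (hinv : ∀ᵐ z ∂P, (κ.sectR z).Invariant (pr.tilted fun θ => ℓ (z, θ))) (n : ℕ) :
    ∃ ϑ ∈ W, dataChainLaw P κ ϑ {ω | ∃ k ≤ n, ω.2 k ∈ B} ≤
      P F + n * ((pr W)⁻¹ * pr A + p) := by
  -- The posterior density is rescaled, for each data set separately, to equal `(pr W)⁻¹` on the
  -- flat region `T`. A factor depending only on the data preserves invariance, and on `W` the
  -- density agrees with that of the conditioned prior.
  set h : Z × E → ℝ≥0∞ := fun x =>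
    (pr W)⁻¹ * ENNReal.ofReal (Real.exp (ℓ x - base x.1)) with hh
  have hhm : Measurable h := by fun_prop
  have hhT : ∀ z, ∀ θ ∈ T, h (z, θ) = (pr W)⁻¹ := by
    intro z θ hθ
    simp [hh, hT z θ hθ]
  have hpr : IsProbabilityMeasure (pr[|W]) := cond_isProbabilityMeasure hW0
  refine exists_dataChainLaw_hit_le P (pr[|W]) κ hA hB hR hF hcross hstep hWB ?_
    (withDensity_bind_dataKernel P pr κ hhm ?_) ?_ ?_ n
  · rw [cond_apply hWm]
    simp
  · refine hinv.mono fun z hz => ?_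
    set Zz := ∫ θ, Real.exp (ℓ (z, θ)) ∂pr with hZz
    have hZ0 : 0 < Zz := integral_exp_pos (hint z)
    have heq : (pr.withDensity fun θ => h (z, θ)) =
        ((pr W)⁻¹ * ENNReal.ofReal (Zz * Real.exp (-base z))) •
          pr.tilted fun θ => ℓ (z, θ) := by
      rw [Measure.tilted, ← withDensity_smul _ (by fun_prop)]
      congr 1
      ext θ
      simp only [hh, Pi.smul_apply, smul_eq_mul]
      rw [mul_assoc, ← ENNReal.ofReal_mul (by positivity), ← hZz, sub_eq_add_neg, Real.exp_add]
      congr 2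
      field_simp
    rw [Kernel.Invariant, heq, Measure.bind_smul, hz.def]
  · refine Measure.le_iff.2 fun s hs => ?_
    rw [withDensity_apply _ hs, ← lintegral_indicator hs,
      lintegral_prod _ (hhm.indicator hs).aemeasurable, Measure.prod_apply hs]
    refine lintegral_mono fun z => ?_
    have hs' : MeasurableSet (Prod.mk z ⁻¹' s) := hs.preimage (by fun_prop)
    dsimp only
    rw [cond_apply hWm, ← setLIntegral_const, ← lintegral_indicator (hWm.inter hs')]
    refine lintegral_mono fun θ => ?_
    by_cases hθ : θ ∈ W ∩ Prod.mk z ⁻¹' s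
    · rw [Set.indicator_of_mem hθ, Set.indicator_of_mem (show (z, θ) ∈ s from hθ.2),
        hhT z θ (hWT hθ.1)]
    · rw [Set.indicator_of_notMem hθ]
      exact zero_le
  · have hs : MeasurableSet ((Set.univ : Set Z) ×ˢ A) := MeasurableSet.univ.prod hA
    rw [withDensity_apply _ hs, ← lintegral_indicator hs,
      lintegral_prod _ (hhm.indicator hs).aemeasurable]
    refine (lintegral_mono (g := fun _ => (pr W)⁻¹ * pr A) fun z => ?_).trans (by simp)
    dsimp only
    rw [← setLIntegral_const, ← lintegral_indicator hA]
    refine lintegral_mono fun θ => ?_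
    by_cases hθ : θ ∈ A
    · rw [Set.indicator_of_mem hθ, Set.indicator_of_mem (show (z, θ) ∈ Set.univ ×ˢ A by simpa),
        hhT z θ (hAT hθ)]
    · rw [Set.indicator_of_notMem (show (z, θ) ∉ Set.univ ×ˢ A by simpa)]
      exact zero_le

lemma WithHighProb.mono {Ω : ℕ → Type} [∀ N, MeasurableSpace (Ω N)] {P : ∀ N, Measure (Ω N)}
    {A B : ∀ N, Set (Ω N)} (hA : WithHighProb P A) (h : ∀ᶠ N in atTop, A N ⊆ B N) :
    WithHighProb P B :=
  tendsto_of_tendsto_of_tendsto_of_le_of_le' tendsto_const_nhds hA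
    (Eventually.of_forall fun _ => zero_le)
    (h.mono fun _ hN => measure_mono (Set.compl_subset_compl.2 hN))

lemma withHighProb_noise_lt {d : ℕ} {𝒳 : Set (Eucl d)} [IsProbabilityMeasure (volume.restrict 𝒳)]
    (m : ℝ) (R : ℕ → ℝ) (D : ℕ → ℕ) {c : ℝ} (hc : 0 < c) :
    WithHighProb (fun N => dataLaw 𝒳 (rampMap m (R N) d) N (0 : Eucl (D N)))
      (fun N => {z | |∑ i, (z i).1| < c * N}) := by
  have hlim : Tendsto (fun N : ℕ => ENNReal.ofReal (1 / (c ^ 2 * N))) atTop (𝓝 0) := by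
    rw [← ENNReal.ofReal_zero]
    refine ENNReal.tendsto_ofReal ?_
    simp only [one_div]
    exact (tendsto_natCast_atTop_atTop.const_mul_atTop (by positivity)).inv_tendsto_atTop
  refine tendsto_of_tendsto_of_tendsto_of_le_of_le' tendsto_const_nhds hlim
    (Eventually.of_forall fun _ => zero_le) ((eventually_ge_atTop 1).mono fun N hN => ?_)
  refine le_trans (measure_mono fun z hz => ?_) (measure_noise_ge_le hN hc)
  simpa using hz

lemma exists_mem_of_hitTime_lt {E : Type} {B : Set E} {ϑ : ℕ → E} {x : ℝ}
    (h : (hitTime B ϑ : ℝ≥0∞) < ENNReal.ofReal x) : ∃ k ≤ ⌊x⌋₊, ϑ k ∈ B := by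
  have htop : hitTime B ϑ ≠ ⊤ := by
    intro h'
    rw [h'] at h
    simp at h
  obtain ⟨k, hk⟩ := ENat.ne_top_iff_exists.1 htop
  have hk' : hittingAfter (fun k (ω : ℕ → E) => ω k) B 0 ϑ ≤ ((k : ℕ) : WithTop ℕ) := hk.ge
  obtain ⟨j, hj, hjB⟩ := hittingAfter_le_iff.1 hk'
  refine ⟨j, hj.2.trans (Nat.le_floor ?_), hjB⟩
  rw [← hk] at h
  simp only [ENat.toENNReal_coe] at h
  rw [← ENNReal.ofReal_natCast, ENNReal.ofReal_lt_ofReal_iff_of_nonneg (by positivity)] at h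
  exact h.le

/-- The bound on the hitting probability tends to zero. -/
lemma floor_mul_exp_le {c₀ : ℝ} (N : ℕ) {x y : ℝ}
    (hx : x ≤ 2 * Real.exp (-(2 * N : ℝ))) (hy : y ≤ Real.exp (-c₀ * N)) :
    (⌊Real.exp (min c₀ 1 * N / 2)⌋₊ : ℝ) * (x + y) ≤ 3 * Real.exp (-(min c₀ 1 / 2 * N)) := by
  have hN : (0 : ℝ) ≤ N := by positivity
  have h1 : x + y ≤ 3 * Real.exp (-(min c₀ 1 * N)) := by
    have h2 : Real.exp (-(2 * N : ℝ)) ≤ Real.exp (-(min c₀ 1 * N)) := by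
      rw [Real.exp_le_exp]
      have := mul_le_mul_of_nonneg_right (min_le_right c₀ 1) hN
      linarith
    have h3 : Real.exp (-c₀ * N) ≤ Real.exp (-(min c₀ 1 * N)) := by
      rw [Real.exp_le_exp]
      have := mul_le_mul_of_nonneg_right (min_le_left c₀ 1) hN
      linarith
    linarith
  calc _ ≤ (⌊Real.exp (min c₀ 1 * N / 2)⌋₊ : ℝ) * (3 * Real.exp (-(min c₀ 1 * N))) := by gcongr
    _ ≤ Real.exp (min c₀ 1 * N / 2) * (3 * Real.exp (-(min c₀ 1 * N))) := by
      gcongr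
      exact Nat.floor_le (Real.exp_pos _).le
    _ = 3 * Real.exp (-(min c₀ 1 / 2 * N)) := by
      rw [mul_left_comm, ← Real.exp_add]
      congr 2
      ring

lemma tendsto_exp_neg_mul_natCast {c : ℝ} (hc : 0 < c) :
    Tendsto (fun N : ℕ => Real.exp (-(c * N))) atTop (𝓝 0) :=
  Real.tendsto_exp_neg_atTop_nhds_zero.comp (tendsto_natCast_atTop_atTop.const_mul_atTop hc)

/-- The hitting time bound for the ramp model at a fixed sample size. -/
lemma exists_start_rampMap {d D N : ℕ} {𝒳 : Set (Eucl d)}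
    [IsProbabilityMeasure (volume.restrict 𝒳)] (pr : Measure (Eucl D)) [IsProbabilityMeasure pr]
    {m R r L η c c₀ : ℝ} (hR : 0 < R) (hr : 2 * R < r) (hL : R ≤ L) (hη : η < R)
    (hW : Real.exp (-(c * N)) ≤ pr.real (annulus D r r))
    (hball : pr.real (Metric.closedBall 0 (2 * R)) ≤ Real.exp (-((c + 2) * N)))
    (htail : pr.real {θ | L ≤ ‖θ‖} ≤ Real.exp (-((c + 2) * N)))
    (κ : Kernel (RegData d N × Eucl D) (Eucl D)) [IsMarkovKernel κ]
    (hinv : ∀ᵐ z ∂(dataLaw 𝒳 (rampMap m R d) N (0 : Eucl D)),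
      (κ.sectR z).Invariant (gibbsPosterior pr (rampMap m R d) z)) :
    ∃ ϑ ∈ annulus D r r, dataChainLaw (dataLaw 𝒳 (rampMap m R d) N (0 : Eucl D)) κ ϑ
        {ω | ENNReal.ofReal (Real.exp (min c₀ 1 * N / 2)) ≤
          (hitTime (Metric.closedBall 0 R) ω.2 : ℝ≥0∞)}ᶜ ≤
      dataLaw 𝒳 (rampMap m R d) N (0 : Eucl D) {z |
        ⨆ θ ∈ Metric.closedBall (0 : Eucl D) L, κ (z, θ) {ϑ | η / 2 ≤ ‖θ - ϑ‖}
          ≤ ENNReal.ofReal (Real.exp (-c₀ * N))}ᶜ +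
      ENNReal.ofReal (3 * Real.exp (-(min c₀ 1 / 2 * N))) := by
  set P := dataLaw 𝒳 (rampMap m R d) N (0 : Eucl D) with hP
  set steps : Set (RegData d N) := {z |
    ⨆ θ ∈ Metric.closedBall (0 : Eucl D) L, κ (z, θ) {ϑ | η / 2 ≤ ‖θ - ϑ‖}
      ≤ ENNReal.ofReal (Real.exp (-c₀ * N))} with hsteps
  set W := annulus D r r with hWdef
  have hWpos : 0 < pr.real W := (Real.exp_pos _).trans_le hW
  have hW0 : pr W ≠ 0 := by
    intro h
    rw [measureReal_def, h] at hWpos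
    simp at hWpos
  set T : Set (Eucl D) := {θ | R ≤ ‖θ‖} with hT
  -- The shell that short steps towards the ball must visit, together with the far region where the
  -- step assumption gives no control.
  set A : Set (Eucl D) := T ∩ (Metric.closedBall 0 (2 * R) ∪ {θ | L ≤ ‖θ‖}) with hA
  have hTm : MeasurableSet T := measurableSet_le measurable_const measurable_norm
  have hAm : MeasurableSet A := hTm.inter (Metric.isClosed_closedBall.measurableSet.union
    (measurableSet_le measurable_const measurable_norm))
  have hWm : MeasurableSet W := (measurableSet_lt measurable_const measurable_norm).inter
    (measurableSet_lt measurable_norm measurable_const)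
  have hRm : MeasurableSet {q : Eucl D × Eucl D | η / 2 ≤ ‖q.1 - q.2‖} :=
    measurableSet_le measurable_const (by fun_prop)
  set base : RegData d N → ℝ := fun z =>
    -(1 / 2) * ∑ i, (z i).1 ^ 2 + m * ∑ i, (z i).1 - N / 2 * m ^ 2 with hbase
  have hflat : ∀ z, ∀ θ ∈ T, logLik (rampMap m R d) z θ = base z := by
    intro z θ hθ
    rw [logLik_rampMap, ramp_eq hR hθ]
  obtain ⟨ϑ, hϑ, h⟩ := exists_dataChainLaw_hit_le_of_flat P pr κ
    (ℓ := fun p => logLik (rampMap m R d) p.1 p.2) measurable_logLik_rampMap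
    (integrable_exp_logLik_rampMap pr) (base := base) (by fun_prop) (T := T) hflat
    (A := A) (B := Metric.closedBall 0 R) (W := W)
    -- The event in the step assumption involves an uncountable supremum and may fail to be
    -- measurable; a measurable hull of its complement has the same measure.
    (R := {q | η / 2 ≤ ‖q.1 - q.2‖}) (F := toMeasurable P stepsᶜ)
    hAm Metric.isClosed_closedBall.measurableSet hWm hRm (measurableSet_toMeasurable _ _)
    Set.inter_subset_left (fun θ hθ => by
      have : r < ‖θ‖ := hθ.1
      show R ≤ ‖θ‖
      linarith) hW0
    (fun x y hx hy => by
      by_cases hxy : η / 2 ≤ ‖x - y‖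
      · exact Or.inr hxy
      -- A step shorter than `η / 2 < R / 2` that ends in the ball of radius `R` must start within
      -- radius `2 * R`.
      · left
        have hx' : R < ‖x‖ := by simpa using hx
        have hy' : ‖y‖ ≤ R := by simpa using hy
        refine ⟨hx'.le, Or.inl ?_⟩
        rw [mem_closedBall_zero_iff]
        have := norm_le_norm_add_norm_sub' x y
        linarith)
    (p := ENNReal.ofReal (Real.exp (-c₀ * N)))
    (fun z x hz hx => by
      have hz' : z ∈ steps := by
        by_contra hcon
        exact hz (subset_toMeasurable _ _ hcon)
      have hxL : x ∈ Metric.closedBall (0 : Eucl D) L := by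
        rw [mem_closedBall_zero_iff]
        by_contra hcon
        exact hx ⟨hL.trans (not_le.1 hcon).le, Or.inr (not_le.1 hcon).le⟩
      exact (le_iSup₂ (f := fun θ (_ : θ ∈ Metric.closedBall (0 : Eucl D) L) =>
        κ (z, θ) {ϑ | η / 2 ≤ ‖θ - ϑ‖}) x hxL).trans hz')
    (fun θ hθ hθ' => by
      have h1 : r < ‖θ‖ := hθ.1
      have h2 : ‖θ‖ ≤ R := by simpa using hθ'
      linarith)
    hinv ⌊Real.exp (min c₀ 1 * N / 2)⌋₊
  refine ⟨ϑ, hϑ, le_trans (measure_mono fun ω hω => ?_) (h.trans ?_)⟩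
  · exact exists_mem_of_hitTime_lt (not_le.1 hω)
  · rw [measure_toMeasurable]
    refine add_le_add le_rfl ?_
    have hratio : (pr W)⁻¹ * pr A = ENNReal.ofReal ((pr.real W)⁻¹ * pr.real A) := by
      rw [ENNReal.ofReal_mul (by positivity), ENNReal.ofReal_inv_of_pos hWpos,
        ofReal_measureReal, ofReal_measureReal]
    have hA2 : (pr.real W)⁻¹ * pr.real A ≤ 2 * Real.exp (-(2 * N : ℝ)) := by
      have hAle : pr.real A ≤ 2 * Real.exp (-((c + 2) * N)) := by
        have h1 := (measureReal_mono (μ := pr) (Set.inter_subset_right (s := T)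
          (t := Metric.closedBall 0 (2 * R) ∪ {θ | L ≤ ‖θ‖}))).trans
            (measureReal_union_le _ _)
        linarith
      rw [inv_mul_le_iff₀ hWpos]
      calc pr.real A ≤ 2 * Real.exp (-((c + 2) * N)) := hAle
        _ = Real.exp (-(c * N)) * (2 * Real.exp (-(2 * N : ℝ))) := by
          rw [mul_left_comm, ← Real.exp_add]
          congr 2
          ring
        _ ≤ _ := by gcongr
    rw [hratio, ← ENNReal.ofReal_add (by positivity) (by positivity), ← ENNReal.ofReal_natCast,
      ← ENNReal.ofReal_mul (by positivity)]
    exact ENNReal.ofReal_le_ofReal (floor_mul_exp_le N hA2 le_rfl)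

end SlowMixing

/-! ### The main theorem: choice of constants and assembly. -/

theorem mainTheorem2 (d : ℕ) (hd : 1 ≤ d)
    (𝒳 : Set (Eucl d)) (h𝒳 : MeasurableSet 𝒳) (h𝒳b : Bornology.IsBounded 𝒳) (h𝒳v : volume 𝒳 = 1)
    (α : ℝ) (hα : (d : ℝ) / 2 < α) (b : ℝ) (hb : b = α / d - 1 / 2)
    (κ : ℝ) (hκ : 0 < κ) (D : ℕ → ℕ)
    (hD : Tendsto (fun N => (D N : ℝ) / (N : ℝ)) atTop (𝓝 κ)) :
    ∃ (G : ∀ N : ℕ, Eucl (D N) → Eucl d → ℝ) (s_b : ℝ),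
      0 < s_b ∧ s_b < 1 / 2 ∧
      -- the regression maps, which are radial
      (∀ N, IsRegressionMap 𝒳 (G N)) ∧
      (∀ N θ θ', ‖θ‖ = ‖θ'‖ → G N θ = G N θ') ∧
      -- i) the expected log-likelihood
      (∀ N : ℕ, 1 ≤ N →
        (∀ θ : Eucl (D N), θ ≠ 0 → expLogLik 𝒳 (G N) N θ < expLogLik 𝒳 (G N) N 0) ∧
        (∃ δ : ℝ, 0 < δ ∧ ConcaveOn ℝ (Metric.ball (0 : Eucl (D N)) δ) (expLogLik 𝒳 (G N) N)) ∧
        (∀ θ θ' : Eucl (D N), ‖θ‖ = ‖θ'‖ → expLogLik 𝒳 (G N) N θ = expLogLik 𝒳 (G N) N θ') ∧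
        (∃ K : ℝ≥0, LipschitzWith K (expLogLik 𝒳 (G N) N)) ∧
        (∀ θ θ' : Eucl (D N), ‖θ‖ ≤ ‖θ'‖ → expLogLik 𝒳 (G N) N θ' ≤ expLogLik 𝒳 (G N) N θ)) ∧
      -- ii) the empirical log-likelihood
      (∀ r : ℝ, 0 < r → WithHighProb (fun N => dataLaw 𝒳 (G N) N 0) (fun N => {z |
        (∀ θ θ' : Eucl (D N), r * (N : ℝ) ^ (-b) ≤ ‖θ‖ → ‖θ‖ = ‖θ'‖ →
          logLik (G N) z θ = logLik (G N) z θ') ∧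
        (∀ θ θ' : Eucl (D N), r * (N : ℝ) ^ (-b) ≤ ‖θ‖ → ‖θ‖ ≤ ‖θ'‖ →
          logLik (G N) z θ' ≤ logLik (G N) z θ)})) ∧
      -- iii) posterior contraction, in probability
      (∀ δ : ℝ, 0 < δ → WithHighProb (fun N => dataLaw 𝒳 (G N) N 0) (fun N => {z |
        |(gibbsPosterior (maternPrior α d (D N)) (G N) z).real
            (Metric.closedBall 0 (s_b * (N : ℝ) ^ (-b))) - 1| < δ})) ∧
      -- iv) the hitting time lower bound
      (∃ ε : ℝ, 0 < ε ∧ ∃ C : ℝ, 0 < C ∧ ∀ (c₀ : ℝ), 0 < c₀ → ∀ (η : ℕ → ℝ),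
        (∀ᶠ N : ℕ in atTop, 0 < η N ∧ η N < s_b * (N : ℝ) ^ (-b)) →
        ∀ (P : ∀ N, Kernel (RegData d N × Eucl (D N)) (Eucl (D N))) [∀ N, IsMarkovKernel (P N)],
        StepAssumption 𝒳 (fun N => maternPrior α d (D N)) G c₀ (fun N => C * √(N : ℝ)) η P →
        ∃ ϑ₀ : ∀ N, Eucl (D N),
          (∀ᶠ N : ℕ in atTop, ϑ₀ N ∈ annulus (D N) ((N : ℝ) ^ (-b)) (ε * (N : ℝ) ^ (-b))) ∧
          WithHighProb (fun N => dataChainLaw (dataLaw 𝒳 (G N) N 0) (P N) (ϑ₀ N)) (fun N => {ω |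
            ENNReal.ofReal (Real.exp (min c₀ 1 * N / 2)) ≤
              (hitTime (Metric.closedBall 0 (s_b * (N : ℝ) ^ (-b))) ω.2 : ℝ≥0∞)})) := by
  have : IsProbabilityMeasure (volume.restrict 𝒳) :=
    ⟨by rw [Measure.restrict_apply_univ]; exact h𝒳v⟩
  have hd0 : (0 : ℝ) < d := by exact_mod_cast hd
  have hα0 : 0 ≤ α := le_trans (by positivity) hα.le
  have hb0 : 0 < b := by
    have : 1 / 2 < α / d := by rw [lt_div_iff₀ hd0]; linarith
    linarith
  -- The constants are chosen in the order `c`, `s`, `C`, `a`, `m`. There is no circularity: the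
  -- hitting time bound uses only flatness beyond `R` and holds for every height `m`, so `m` can be
  -- adapted at the end to the prior mass near `0`.
  obtain ⟨c, hc, hW⟩ := exists_exp_le_maternPrior_annulus hκ hD hα0 hb hb0 one_pos
  obtain ⟨s, hs0, hs2, hball⟩ := exists_maternPrior_closedBall_le_exp hκ hD hα0 hb hb0 (c + 2)
  obtain ⟨C, hC0, htail⟩ := exists_maternPrior_tail_le_exp (d := d) hκ hD hα0
    (show 0 ≤ c + 2 by linarith)
  -- The annulus from `s/4` to `s/2` times `N^(-b)` lies in the ball of radius `R / 2`, whose mass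
  -- is what posterior contraction needs.
  obtain ⟨a, ha, hsmall⟩ := exists_exp_le_maternPrior_annulus hκ hD hα0 hb hb0
    (show 0 < s / 4 by positivity)
  set m := 2 * (a + 1) with hm
  have hm0 : 0 < m := by positivity
  have hR0 : ∀ N : ℕ, 1 ≤ N → 0 < s * (N : ℝ) ^ (-b) := fun N hN => by
    have : (0 : ℝ) < N := by exact_mod_cast hN
    positivity
  have hRnn : ∀ N : ℕ, 0 ≤ s * (N : ℝ) ^ (-b) := fun N => by positivity
  refine ⟨fun N => rampMap m (s * (N : ℝ) ^ (-b)) d, s, hs0, hs2,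
    fun N => isRegressionMap_rampMap, fun N θ θ' h => by ext; simp only [rampMap, ramp, h],
    fun N hN => ⟨fun θ hθ => ?_, ⟨_, hR0 N hN, concaveOn_expLogLik (hR0 N hN)⟩,
      fun θ θ' h => ?_, exists_lipschitzWith_expLogLik hm0.le (hR0 N hN), fun θ θ' h => ?_⟩,
    fun r hr => ?_, fun δ hδ => ?_, 1, one_pos, C, hC0, fun c₀ hc₀ η hη P _ hP => ?_⟩
  · have hN0 : (0 : ℝ) < N := by exact_mod_cast hN
    have hv := ramp_pos hm0 (hR0 N hN) hθ
    rw [expLogLik_rampMap, expLogLik_rampMap, ramp_zero]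
    have : 0 < (N / 2 : ℝ) * ramp m (s * (N : ℝ) ^ (-b)) θ ^ 2 := by positivity
    linarith
  · simp only [expLogLik_rampMap, ramp, h]
  · rw [expLogLik_rampMap, expLogLik_rampMap]
    have h1 := pow_le_pow_left₀ (ramp_nonneg hm0.le (hRnn N) θ)
      (ramp_le_ramp hm0.le (hRnn N) h) 2
    have h2 := mul_le_mul_of_nonneg_left h1 (show (0 : ℝ) ≤ N / 2 by positivity)
    linarith
  -- The threshold `m * min 1 (r / s)` is the ramp height at radius `r N^(-b)`. It does not depend
  -- on `N`, so the mean noise falls below it with high probability.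
  · refine (withHighProb_noise_lt m (fun N : ℕ => s * (N : ℝ) ^ (-b)) D
      (c := m * min 1 (r / s)) (by positivity)).mono ?_
    filter_upwards [eventually_ge_atTop 1] with N hN z hz
    have hN0 : (0 : ℝ) < N := by exact_mod_cast hN
    refine ⟨fun θ θ' _ h => by simp only [logLik_rampMap, ramp, h], fun θ θ' hrθ h => ?_⟩
    refine logLik_rampMap_anti hm0.le (hRnn N) ((le_abs_self _).trans (le_of_lt hz)) ?_ h
    refine mul_le_mul_of_nonneg_left (min_le_min le_rfl ?_) hm0.le
    rw [le_div_iff₀ (hR0 N hN)]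
    calc r / s * (s * (N : ℝ) ^ (-b)) = r * (N : ℝ) ^ (-b) := by field_simp
      _ ≤ ‖θ‖ := hrθ
  · refine (withHighProb_noise_lt m (fun N : ℕ => s * (N : ℝ) ^ (-b)) D
      (c := 1 / 6) (by norm_num)).mono ?_
    have hexp := (tendsto_exp_neg_mul_natCast one_pos).eventually_lt_const hδ
    filter_upwards [eventually_ge_atTop 1, hsmall, hexp] with N hN hsN hδN z hz
    have hpr : Real.exp (-(a * N)) ≤ (maternPrior α d (D N)).real
        (Metric.closedBall 0 (s * (N : ℝ) ^ (-b) / 2)) := by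
      refine hsN.trans (measureReal_mono fun θ hθ => ?_)
      rw [mem_closedBall_zero_iff]
      linarith [hθ.2]
    have h := gibbsPosterior_compl_closedBall_le (maternPrior α d (D N)) (hR0 N hN) ha hm hpr
      (z := z) (le_of_lt hz)
    have hprob : IsProbabilityMeasure (gibbsPosterior (maternPrior α d (D N))
        (rampMap m (s * (N : ℝ) ^ (-b)) d) z) :=
      isProbabilityMeasure_tilted (integrable_exp_logLik_rampMap _ z)
    rw [probReal_compl_eq_one_sub Metric.isClosed_closedBall.measurableSet] at h
    show |_ - 1| < δ
    rw [abs_sub_comm, abs_of_nonneg (sub_nonneg.2 measureReal_le_one)]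
    rw [one_mul] at hδN
    exact h.trans_lt hδN
  · have hL : ∀ᶠ N : ℕ in atTop, s * (N : ℝ) ^ (-b) ≤ C * √(N : ℝ) := by
      have h1 : Tendsto (fun N : ℕ => C * √(N : ℝ)) atTop atTop :=
        (Real.tendsto_sqrt_atTop.comp tendsto_natCast_atTop_atTop).const_mul_atTop hC0
      filter_upwards [h1.eventually_ge_atTop 1, eventually_ge_atTop 1] with N hN hN1
      refine le_trans ?_ hN
      have h2 : (N : ℝ) ^ (-b) ≤ 1 :=
        Real.rpow_le_one_of_one_le_of_nonpos (by exact_mod_cast hN1) (by linarith)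
      exact mul_le_one₀ (by linarith) (by positivity) h2
    set bad : ∀ N : ℕ, Eucl (D N) → ℝ≥0∞ := fun N ϑ =>
      dataChainLaw (dataLaw 𝒳 (rampMap m (s * (N : ℝ) ^ (-b)) d) N 0) (P N) ϑ
        {ω | ENNReal.ofReal (Real.exp (min c₀ 1 * N / 2)) ≤
          (hitTime (Metric.closedBall 0 (s * (N : ℝ) ^ (-b))) ω.2 : ℝ≥0∞)}ᶜ with hbad
    set bound : ℕ → ℝ≥0∞ := fun N =>
      dataLaw 𝒳 (rampMap m (s * (N : ℝ) ^ (-b)) d) N (0 : Eucl (D N)) {z |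
        ⨆ θ ∈ Metric.closedBall (0 : Eucl (D N)) (C * √(N : ℝ)),
          P N (z, θ) {ϑ | η N / 2 ≤ ‖θ - ϑ‖} ≤ ENNReal.ofReal (Real.exp (-c₀ * N))}ᶜ +
      ENNReal.ofReal (3 * Real.exp (-(min c₀ 1 / 2 * N))) with hbound
    have hgood : ∀ᶠ N : ℕ in atTop,
        ∃ ϑ, ϑ ∈ annulus (D N) ((N : ℝ) ^ (-b)) (1 * (N : ℝ) ^ (-b)) ∧ bad N ϑ ≤ bound N := by
      filter_upwards [eventually_ge_atTop 1, hL, hη, hW, hball, htail, hP.invariant] with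
        N hN hLN hηN hWN hballN htailN hinvN
      have hN0 : (0 : ℝ) < N := by exact_mod_cast hN
      have hNb : (0 : ℝ) < (N : ℝ) ^ (-b) := by positivity
      rw [one_mul] at hWN ⊢
      exact exists_start_rampMap (maternPrior α d (D N)) (c₀ := c₀) (hR0 N hN)
        (by nlinarith) hLN hηN.2 hWN hballN htailN (P N) hinvN
    -- A starting point is needed for every `N`; the value `0` serves for the indices without a good
    -- one, which are not eventually relevant.
    have hchoice : ∀ N : ℕ, ∃ ϑ,
        (∃ ϑ', ϑ' ∈ annulus (D N) ((N : ℝ) ^ (-b)) (1 * (N : ℝ) ^ (-b)) ∧ bad N ϑ' ≤ bound N) →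
          ϑ ∈ annulus (D N) ((N : ℝ) ^ (-b)) (1 * (N : ℝ) ^ (-b)) ∧ bad N ϑ ≤ bound N := by
      intro N
      by_cases h : ∃ ϑ', ϑ' ∈ annulus (D N) ((N : ℝ) ^ (-b)) (1 * (N : ℝ) ^ (-b)) ∧
          bad N ϑ' ≤ bound N
      · exact ⟨h.choose, fun _ => h.choose_spec⟩
      · exact ⟨0, fun h' => absurd h' h⟩
    choose ϑ₀ hϑ₀ using hchoice
    refine ⟨ϑ₀, hgood.mono fun N hN => (hϑ₀ N hN).1, ?_⟩
    have hlim : Tendsto bound atTop (𝓝 0) := by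
      have h1 : Tendsto (fun N : ℕ => ENNReal.ofReal (3 * Real.exp (-(min c₀ 1 / 2 * N)))) atTop
          (𝓝 0) := by
        rw [← ENNReal.ofReal_zero]
        refine ENNReal.tendsto_ofReal ?_
        rw [← mul_zero (3 : ℝ)]
        exact (tendsto_exp_neg_mul_natCast (by positivity)).const_mul 3
      rw [← add_zero (0 : ℝ≥0∞)]
      exact Tendsto.add hP.steps h1
    exact tendsto_of_tendsto_of_tendsto_of_le_of_le' tendsto_const_nhds hlim
      (Eventually.of_forall fun _ => zero_le) (hgood.mono fun N hN => (hϑ₀ N hN).2)
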